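/- **Model.** A base station at the origin of the plane serves $M$ users whose positions are i.i.d. uniform on the disc of radius $R_D>0$. Eavesdroppers form a homogeneous Poisson point process $\Phi_e$ of density $\lambda_e>0$ on the plane, and only those at distance $d_e\ge r_p$ $(r_p>1)$ are active. All fading coefficients are independent $\mathcal{CN}(0,1)$, independent of all positions; users and eavesdroppers are independent. With path-loss exponent $\alpha>0$, a user at distance $d$ with fading coefficient $\tilde g$ has channel gain $|\tilde g|^2/(1+d^\alpha)$; let $|h_1|^2\le\dots\le|h_M|^2$ be the ordered gains. Let $1\le m<n\le M$, $a_m>a_n>0$, $a_m+a_n=1$, let $\rho_b,\rho_e>0$ be the transmit SNRs at the users and at the eavesdroppers, and put $$\gamma_{B_m}=\frac{a_m|h_m|^2}{a_n|h_m|^2+1/\rho_b},\qquad \gamma_{E_m}=\rho_e a_m\sup_{e\in\Phi_e,\ d_e\ge r_p}\frac{|g_e|^2}{d_e^{\alpha}},\qquad C_m=\big[\log_2(1+\gamma_{B_m})-\log_2(1+\gamma_{E_m})\big]^+ ,$$ where $g_e$ is the fading coefficient of eavesdropper $e$. The secrecy outage probability of the $m$-th user for the target rate $R_m>0$ is $P_m(R_m)=\Pr\{C_m<R_m\}$.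 Put $\delta=2/\alpha$, $\mu_{m1}=\delta\pi\lambda_e(\rho_e a_m)^\delta$, $\mu_{m2}=r_p^\alpha/(\rho_e a_m)$, $\varphi_m=\frac{M!}{(M-m)!\,(m-1)!}$, let $\Gamma(\cdot,\cdot)$ be the upper incomplete Gamma function, $$f(x)=\mu_{m1}e^{-\mu_{m1}\Gamma(\delta,\mu_{m2}x)/x^\delta}\Big(\frac{\mu_{m2}^\delta e^{-\mu_{m2}x}}{x}+\frac{\delta\,\Gamma(\delta,\mu_{m2}x)}{x^{\delta+1}}\Big),\qquad y(x)=\frac{2^{R_m}(1+x)-1}{\big(a_m-a_n(2^{R_m}(1+x)-1)\big)\rho_b},$$ and assume $\tau_m=\frac{1}{2^{R_m}(1-a_m)}-1>0$. For a function $F$ write $$\mathcal P[F]=1-e^{-\mu_{m1}\Gamma(\delta,\tau_m\mu_{m2})/\tau_m^\delta}+\int_0^{\tau_m}f(x)\,\varphi_m\sum_{p=0}^{M-m}\binom{M-m}{p}\frac{(-1)^p}{m+p}F(y(x))^{m+p}\,dx .$$ For $K\ge1$ and $1\le k\le K$ let $\phi_k=\cos\frac{(2k-1)\pi}{2K}$,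 $b_k=-\frac{\pi}{2K}\sqrt{1-\phi_k^2}\,(\phi_k+1)$, $c_k=1+\big[\tfrac{R_D}{2}(\phi_k+1)\big]^\alpha$, and $b_0=-\sum_{k=1}^K b_k$, $c_0=0$. Let $F_{\tilde h}(y)=\frac{2}{R_D^2}\int_0^{R_D}\big(1-e^{-(1+r^\alpha)y}\big)r\,dr$ be the CDF of an unordered gain and $F_{\tilde h}^{(K)}(y)=\sum_{k=0}^K b_ke^{-c_ky}$ its $K$-node Gauss–Chebyshev approximation. **Theorem.** Almost surely $\gamma_{E_m}<\infty$, and $P_m(R_m)=\mathcal P[F_{\tilde h}]$. For every $K\ge1$, replacing $F_{\tilde h}$ by $F_{\tilde h}^{(K)}$ gives $$\mathcal P[F_{\tilde h}^{(K)}]=P_m^{(K)}(R_m):=1-e^{-\frac{\mu_{m1}\Gamma(\delta,\tau_m\mu_{m2})}{\tau_m^\delta}}+\varphi_m\sum_{p=0}^{M-m}\binom{M-m}{p}\frac{(-1)^p}{m+p}\sum_{q_0+\dots+q_K=m+p}\frac{(m+p)!}{q_0!\cdots q_K!}\Big(\prod_{k=0}^Kb_k^{q_k}\Big)\int_0^{\tau_m}f(x)\,e^{-\sum_{k=0}^Kq_kc_k\,y(x)}\,dx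 ,$$ where all the integrals converge absolutely. Moreover $P_m^{(K)}(R_m)$ approximates the secrecy outage probability in the sense that $\lim_{K\to\infty}P_m^{(K)}(R_m)=P_m(R_m)$. -/

import Mathlib

open MeasureTheory ProbabilityTheory

/-- Parameters of the single-antenna NOMA downlink: `M` users, the paired ranks `m < n`,
user-zone radius `RD`, path-loss exponent `α`, eavesdropper density `lam`, radius `rp` of the
eavesdropper-exclusion zone, transmit SNRs `ρb`, `ρe`, power coefficients `am`, `an`. -/
structure NOMAParams where
  M : ℕ
  m : ℕ
  n : ℕ
  one_le_m : 1 ≤ m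
  m_lt_n : m < n
  n_le_M : n ≤ M
  RD : ℝ
  RD_pos : 0 < RD
  α : ℝ
  α_pos : 0 < α
  lam : ℝ
  lam_pos : 0 < lam
  rp : ℝ
  one_lt_rp : 1 < rp
  ρb : ℝ
  ρb_pos : 0 < ρb
  ρe : ℝ
  ρe_pos : 0 < ρe
  am : ℝ
  an : ℝ
  an_pos : 0 < an
  an_lt_am : an < am
  am_add_an : am + an = 1

/-- The Euclidean plane; the base station is at the origin. -/
abbrev Plane := EuclideanSpace ℝ (Fin 2)

/-- The circularly symmetric complex Gaussian law `CN(0,1)`, with density `exp(-|z|²)/π`. -/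
noncomputable def complexGaussian : Measure ℂ :=
  volume.withDensity fun z => ENNReal.ofReal (Real.exp (-‖z‖ ^ 2) / Real.pi)

/-- The points `X 0, X 1, …` form a homogeneous Poisson point process of density `lam` on the
plane: the numbers of points in disjoint bounded Borel sets are independent, and the number of
points in `B` is Poisson with mean `lam * area B`. -/
def IsHomogeneousPPP {Ω : Type*} [MeasurableSpace Ω] (X : ℕ → Ω → Plane) (lam : ℝ)
    (μ : Measure Ω) : Prop :=
  (∀ e, Measurable (X e)) ∧
  ∀ (r : ℕ) (B : Fin r → Set Plane),
    (∀ j, MeasurableSet (B j)) → (∀ j, Bornology.IsBounded (B j)) →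
    (Pairwise fun i j => Disjoint (B i) (B j)) →
    ∀ k : Fin r → ℕ,
      μ.real {ω | ∀ j, {e | X e ω ∈ B j}.encard = (k j : ℕ∞)} =
        ∏ j, Real.exp (-(lam * volume.real (B j))) * (lam * volume.real (B j)) ^ k j
          / (k j).factorial

/-- The `k`-th smallest entry (`k = 0` is the smallest) of a finite family of reals. -/
noncomputable def orderStat {M : ℕ} (v : Fin M → ℝ) (k : Fin M) : ℝ := v (Tuple.sort v k)

namespace NOMAParams

variable (p : NOMAParams)

/-- The 0-based rank of the `m`-th weakest user. -/
def rankm : Fin p.M :=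
  ⟨p.m - 1, by have := p.one_le_m; have := p.m_lt_n; have := p.n_le_M; omega⟩

/-- `δ = 2 / α`. -/
noncomputable def δ : ℝ := 2 / p.α

/-- `μ_{m1} = δ π λ_e (ρ_e a_m)^δ`. -/
noncomputable def μ1 : ℝ := p.δ * Real.pi * p.lam * (p.ρe * p.am) ^ p.δ

/-- `μ_{m2} = r_p^α / (ρ_e a_m)`. -/
noncomputable def μ2 : ℝ := p.rp ^ p.α / (p.ρe * p.am)

/-- `τ_m = 1 / (2^R (1 - a_m)) - 1`. -/
noncomputable def τ (R : ℝ) : ℝ := 1 / (2 ^ R * (1 - p.am)) - 1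

end NOMAParams

/-- The random network: user positions `U` and fading `G`, eavesdropper positions `X` and
fading `g`. The users are i.i.d. uniform on the disc of radius `RD`, the eavesdroppers form a
homogeneous Poisson point process, all fading coefficients are i.i.d. `CN(0,1)`, and all these
objects are mutually independent. -/
structure NOMANetwork (p : NOMAParams) {Ω : Type*} [MeasurableSpace Ω] (μ : Measure Ω) where
  U : Fin p.M → Ω → Plane
  G : Fin p.M → Ω → ℂ
  X : ℕ → Ω → Plane
  g : ℕ → Ω → ℂ
  measurable_U : ∀ i, Measurable (U i)
  measurable_G : ∀ i, Measurable (G i)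
  measurable_g : ∀ e, Measurable (g e)
  uniform_U : ∀ i, pdf.IsUniform (U i) (Metric.closedBall 0 p.RD) μ
  law_G : ∀ i, μ.map (G i) = complexGaussian
  ppp_X : IsHomogeneousPPP X p.lam μ
  law_g : ∀ e, μ.map (g e) = complexGaussian
  indep_U : iIndepFun U μ
  indep_G : iIndepFun G μ
  indep_g : iIndepFun g μ
  indep_users : IndepFun (fun ω i => U i ω) (fun ω i => G i ω) μ
  indep_eves : IndepFun (fun ω e => X e ω) (fun ω e => g e ω) μ
  indep_users_eves : IndepFun (fun ω => ((fun i => U i ω), (fun i => G i ω)))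
    (fun ω => ((fun e => X e ω), (fun e => g e ω))) μ

namespace NOMANetwork

variable {p : NOMAParams} {Ω : Type*} [MeasurableSpace Ω] {μ : Measure Ω} (N : NOMANetwork p μ)

/-- Unordered channel power gain of user `i`, with bounded path loss `1 / (1 + d^α)`. -/
noncomputable def gain (ω : Ω) (i : Fin p.M) : ℝ := ‖N.G i ω‖ ^ 2 / (1 + ‖N.U i ω‖ ^ p.α)

/-- Ordered channel power gain `|h_m|²` of the `m`-th weakest user. -/
noncomputable def gainm (ω : Ω) : ℝ := orderStat (N.gain ω) p.rankm

/-- SINR `γ_{B_m}` of the `m`-th user. -/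
noncomputable def sinrB (ω : Ω) : ℝ := p.am * N.gainm ω / (p.an * N.gainm ω + 1 / p.ρb)

/-- Channel power gains `|g_e|² / d_e^α` of the eavesdroppers outside the exclusion zone. -/
def eveGains (ω : Ω) : Set ℝ :=
  {y | ∃ e, p.rp ≤ ‖N.X e ω‖ ∧ y = ‖N.g e ω‖ ^ 2 * (1 / ‖N.X e ω‖ ^ p.α)}

/-- SNR `γ_{E_m}` of the most detrimental eavesdropper for the `m`-th user's signal. -/
noncomputable def snrE (ω : Ω) : ℝ := p.ρe * p.am * sSup (N.eveGains ω)

/-- Secrecy rate `C_m = [log₂(1 + γ_{B_m}) - log₂(1 + γ_{E_m})]⁺`. -/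
noncomputable def secrecyRate (ω : Ω) : ℝ :=
  max (Real.logb 2 (1 + N.sinrB ω) - Real.logb 2 (1 + N.snrE ω)) 0

/-- Secrecy outage probability of the `m`-th user for the target secrecy rate `R`. -/
noncomputable def sop (R : ℝ) : ℝ := μ.real {ω | N.secrecyRate ω < R}

end NOMANetwork

/-- Upper incomplete Gamma function `Γ(s, x)`. -/
noncomputable def upperGamma (s x : ℝ) : ℝ := ∫ t in Set.Ioi x, t ^ (s - 1) * Real.exp (-t)

namespace NOMAParams

variable (p : NOMAParams)

/-- CDF `F_{E_m}(x) = exp(-μ_{m1} Γ(δ, μ_{m2} x) / x^δ)` of the eavesdropper SNR, `x > 0`. -/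
noncomputable def cdfE (x : ℝ) : ℝ := Real.exp (-(p.μ1 * upperGamma p.δ (p.μ2 * x) / x ^ p.δ))

/-- The factor of the eavesdropper SNR density in front of the exponential. -/
noncomputable def preE (x : ℝ) : ℝ :=
  p.μ1 * (p.μ2 ^ p.δ * Real.exp (-(p.μ2 * x)) / x
    + p.δ * upperGamma p.δ (p.μ2 * x) / x ^ (p.δ + 1))

/-- The gain threshold `(2^R (1+x) - 1) / ((a_m - a_n (2^R (1+x) - 1)) ρ_b)`. -/
noncomputable def thr (R x : ℝ) : ℝ :=
  (2 ^ R * (1 + x) - 1) / ((p.am - p.an * (2 ^ R * (1 + x) - 1)) * p.ρb)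

/-- `φ_m = M! / ((M - m)! (m - 1)!)`. -/
noncomputable def φ : ℝ := p.M.factorial / ((p.M - p.m).factorial * (p.m - 1).factorial)

/-- CDF of an unordered channel gain (no approximation). -/
noncomputable def cdfU (y : ℝ) : ℝ :=
  2 / p.RD ^ 2 * ∫ r in (0 : ℝ)..p.RD, (1 - Real.exp (-((1 + r ^ p.α) * y))) * r

/-- CDF of the `m`-th smallest of `M` independent gains with common CDF `F`. -/
noncomputable def cdfOrd (F : ℝ → ℝ) (y : ℝ) : ℝ :=
  p.φ * ∑ l ∈ Finset.range (p.M - p.m + 1),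
    ((p.M - p.m).choose l : ℝ) * ((-1) ^ l / (p.m + l : ℝ)) * F y ^ (p.m + l)

/-- Chebyshev nodes `φ_k = cos((2k-1)π / (2K))`. -/
noncomputable def node (K k : ℕ) : ℝ := Real.cos ((2 * k - 1) / (2 * K) * Real.pi)

/-- Quadrature coefficients `b_k` for `1 ≤ k ≤ K`. -/
noncomputable def bPos (K k : ℕ) : ℝ :=
  -(Real.pi / (2 * K)) * √(1 - node K k ^ 2) * (node K k + 1)

/-- Quadrature coefficients: `b_0 = -∑_{k=1}^K b_k`. -/
noncomputable def b (K k : ℕ) : ℝ := if k = 0 then -∑ j ∈ Finset.Icc 1 K, bPos K j else bPos K k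

/-- Quadrature exponents: `c_0 = 0` and `c_k = 1 + (RD/2 (φ_k + 1))^α` for `1 ≤ k ≤ K`. -/
noncomputable def c (K k : ℕ) : ℝ :=
  if k = 0 then 0 else 1 + (p.RD / 2 * (node K k + 1)) ^ p.α

/-- Gauss–Chebyshev approximation `∑_{k=0}^K b_k exp(-c_k y)` of the unordered CDF. -/
noncomputable def cdfUGC (K : ℕ) (y : ℝ) : ℝ :=
  ∑ k ∈ Finset.range (K + 1), b K k * Real.exp (-(p.c K k * y))

/-- The secrecy outage probability as an integral, for a common gain CDF `F`. -/
noncomputable def sopWith (F : ℝ → ℝ) (R : ℝ) : ℝ :=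
  1 - p.cdfE (p.τ R) + ∫ x in (0 : ℝ)..p.τ R, p.preE x * p.cdfE x * p.cdfOrd F (p.thr R x)

/-- The integrand belonging to the exponents `q = (q_0, …, q_K)`. -/
noncomputable def integrand (K : ℕ) (R : ℝ) (q : Fin (K + 1) → ℕ) (x : ℝ) : ℝ :=
  p.preE x * Real.exp (-(p.μ1 * upperGamma p.δ (p.μ2 * x) / x ^ p.δ)
    - ∑ k : Fin (K + 1), (q k : ℝ) * p.c K k * p.thr R x)

/-- The closed form with `K` quadrature nodes; `q` runs through the tuples of natural numbers
`(q_0, …, q_K)` with `q_0 + ⋯ + q_K = m + l`. -/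
noncomputable def sopFormula (K : ℕ) (R : ℝ) : ℝ :=
  1 - Real.exp (-(p.μ1 * upperGamma p.δ (p.τ R * p.μ2) / p.τ R ^ p.δ)) +
    p.φ * ∑ l ∈ Finset.range (p.M - p.m + 1),
      ((p.M - p.m).choose l : ℝ) * ((-1) ^ l / (p.m + l : ℝ)) *
        ∑ q ∈ Finset.piAntidiag (Finset.univ : Finset (Fin (K + 1))) (p.m + l),
          (Nat.multinomial Finset.univ q : ℝ) * (∏ k : Fin (K + 1), b K k ^ q k) *
            ∫ x in (0 : ℝ)..p.τ R, p.integrand K R q x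

end NOMAParams

/-! The outage probability is computed by conditioning on the eavesdropper SNR `x`. By
`secrecy_outage_iff` the outage event is linear in the ordered gain. For `x` at least `τ` it always
occurs; below `τ` it says that the gain is smaller than `thr R x`. Since users and eavesdroppers are
independent, two laws suffice, and `sop_eq` integrates one against the other.

For the users, polar coordinates give the CDF of a single gain (`real_gain_lt`). The ordered gain is
below `y` exactly when enough unordered gains are, so its CDF is a binomial tail, which
`sum_bernstein_tail_eval` rewrites as the alternating sum in `cdfOrd`.

For the eavesdroppers, cut an annulus into thin rings and freeze the fading threshold on each. Given
the positions, the no-violation probability is a product of powers of the ring counts. The Poisson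
generating function then gives the exponential of a Riemann sum (`real_forall_eve_le`). Refining the
rings (`real_eve_le_annulus`) and letting the annulus grow (`real_eve_le`) yields an exponential
integral, evaluated by an incomplete Gamma function. This CDF tends to 1 at infinity, hence the
supremum is almost surely finite. It tends to 0 at `0+`, hence its derivative is a density with no
atom left over (`map_snrE`).

For the approximation, the substitution `r = RD/2 (cos θ + 1)` turns the unordered CDF into an
integral over `[0, π]`, and the Gauss–Chebyshev sum is its midpoint rule. It therefore converges
pointwise and is bounded by `π` uniformly in the number of nodes. Dominated convergence against the
SNR density gives the limit, while the multinomial theorem gives the closed form for each fixed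
number of nodes. -/

/-! ### Conditioning, and the laws of the fading and of the user positions -/

/-- Fubini for the product law. It serves three conditionings: on a user's position, on the
eavesdropper positions, and on the eavesdropper SNR. -/
theorem measureReal_mem_of_indepFun {Ω β γ : Type*} [MeasurableSpace Ω] [MeasurableSpace β]
    [MeasurableSpace γ] {μ : Measure Ω} [IsProbabilityMeasure μ] {X : Ω → β} {Y : Ω → γ}
    (hX : Measurable X) (hY : Measurable Y) (hXY : IndepFun X Y μ) {S : Set (β × γ)}
    (hS : MeasurableSet S) :
    μ.real {ω | (X ω, Y ω) ∈ S} = ∫ ω, μ.real {ω' | (X ω, Y ω') ∈ S} ∂μ := by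
  have : IsProbabilityMeasure (μ.map X) := Measure.isProbabilityMeasure_map hX.aemeasurable
  have : IsProbabilityMeasure (μ.map Y) := Measure.isProbabilityMeasure_map hY.aemeasurable
  have h1 : μ {ω | (X ω, Y ω) ∈ S} = ∫⁻ ω, μ {ω' | (X ω, Y ω') ∈ S} ∂μ := by
    have := (indepFun_iff_map_prod_eq_prod_map_map hX.aemeasurable hY.aemeasurable).1 hXY
    have h2 : μ {ω | (X ω, Y ω) ∈ S} = μ.map (fun ω => (X ω, Y ω)) S :=
      (Measure.map_apply (hX.prodMk hY) hS).symm
    rw [h2, this, Measure.prod_apply hS, lintegral_map (measurable_measure_prodMk_left hS) hX]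
    refine lintegral_congr fun ω => ?_
    rw [Measure.map_apply hY (measurable_prodMk_left hS)]
    rfl
  have hm : Measurable fun ω => μ {ω' | (X ω, Y ω') ∈ S} := by
    have : (fun ω => μ {ω' | (X ω, Y ω') ∈ S}) =
        (fun x => μ.map Y (Prod.mk x ⁻¹' S)) ∘ X := by
      funext ω
      simp only [Function.comp]
      rw [Measure.map_apply hY (measurable_prodMk_left hS)]
      rfl
    rw [this]
    exact (measurable_measure_prodMk_left hS).comp hX
  rw [measureReal_def, h1]
  simp only [measureReal_def]
  rw [integral_toReal hm.aemeasurable (Filter.Eventually.of_forall fun ω => measure_lt_top _ _)]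

theorem integral_mul_exp_neg_sq (a : ℝ) :
    ∫ r in (0 : ℝ)..a, r * (Real.exp (-r ^ 2) / Real.pi) =
      (1 - Real.exp (-a ^ 2)) / (2 * Real.pi) := by
  have h : ∀ x ∈ Set.uIcc 0 a, HasDerivAt (fun r : ℝ => -Real.exp (-r ^ 2) / (2 * Real.pi))
      (x * (Real.exp (-x ^ 2) / Real.pi)) x := by
    intro x _
    have h1 : HasDerivAt (fun r : ℝ => -r ^ 2) (-(2 * x)) x := by
      exact (hasDerivAt_pow 2 x).neg.congr_deriv (by simp)
    refine (h1.exp.neg.div_const (2 * Real.pi)).congr_deriv ?_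
    field_simp
  rw [intervalIntegral.integral_eq_sub_of_hasDerivAt h
    (Continuous.intervalIntegrable (by fun_prop) _ _)]
  simp
  ring

/-- Polar coordinates: the squared modulus is exponential with mean one, because `r exp(-r²)` has an
elementary primitive. -/
theorem complexGaussian_real_norm_sq_lt {t : ℝ} (ht : 0 ≤ t) :
    complexGaussian.real {z | ‖z‖ ^ 2 < t} = 1 - Real.exp (-t) := by
  have hS : MeasurableSet {z : ℂ | ‖z‖ ^ 2 < t} :=
    measurableSet_lt (by fun_prop) measurable_const
  have h0 : complexGaussian.real {z | ‖z‖ ^ 2 < t} =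
      ∫ z in {z : ℂ | ‖z‖ ^ 2 < t}, Real.exp (-‖z‖ ^ 2) / Real.pi := by
    rw [measureReal_def, complexGaussian, withDensity_apply _ hS,
      integral_eq_lintegral_of_nonneg_ae]
    · exact Filter.Eventually.of_forall fun z => by positivity
    · exact Measurable.aestronglyMeasurable (by fun_prop)
  have h1 : (fun z : ℂ => Set.indicator {z : ℂ | ‖z‖ ^ 2 < t}
      (fun z => Real.exp (-‖z‖ ^ 2) / Real.pi) z) =
      fun z => (fun r : ℝ => Set.indicator {r : ℝ | r ^ 2 < t}
        (fun r => Real.exp (-r ^ 2) / Real.pi) r) ‖z‖ := by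
    funext z
    simp [Set.indicator]
  rw [h0, ← integral_indicator hS, h1, integral_fun_norm_addHaar]
  have h2 : ∫ y in Set.Ioi (0 : ℝ), y ^ (Module.finrank ℝ ℂ - 1) •
      (Set.indicator {r : ℝ | r ^ 2 < t} (fun r => Real.exp (-r ^ 2) / Real.pi) y) =
      ∫ r in (0 : ℝ)..√t, r * (Real.exp (-r ^ 2) / Real.pi) := by
    rw [intervalIntegral.integral_of_le (Real.sqrt_nonneg t),
      integral_Ioc_eq_integral_Ioo, ← integral_indicator measurableSet_Ioo,
      ← integral_indicator measurableSet_Ioi]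
    congr 1
    funext r
    by_cases hr : 0 < r
    · simp [Set.indicator, hr, Real.lt_sqrt hr.le]
    · simp [Set.indicator, hr]
  rw [h2, integral_mul_exp_neg_sq, Real.sq_sqrt ht]
  simp [measureReal_def]
  field_simp

/-- The two events differ by a circle, which is null. The strict form serves the users, this one the
eavesdroppers. -/
theorem complexGaussian_real_norm_sq_le {t : ℝ} (ht : 0 ≤ t) :
    complexGaussian.real {z | ‖z‖ ^ 2 ≤ t} = 1 - Real.exp (-t) := by
  rw [← complexGaussian_real_norm_sq_lt ht]
  refine measureReal_congr ?_
  have hac : complexGaussian ≪ volume := withDensity_absolutelyContinuous _ _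
  have h0 : volume (Metric.sphere (0 : ℂ) √t) = 0 := Measure.addHaar_sphere _ _ _
  have h1 : ∀ᵐ z ∂complexGaussian, z ∉ Metric.sphere (0 : ℂ) √t :=
    measure_eq_zero_iff_ae_notMem.1 (hac h0)
  filter_upwards [h1] with z hz
  apply propext
  change ‖z‖ ^ 2 ≤ t ↔ ‖z‖ ^ 2 < t
  refine ⟨fun h => lt_of_le_of_ne h fun h' => hz ?_, le_of_lt⟩
  simp [← h', Real.sqrt_sq]

theorem integral_norm_of_isUniform_closedBall {Ω : Type*} [MeasurableSpace Ω] {μ : Measure Ω}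
    {U : Ω → Plane} {r₀ : ℝ} (hr : 0 < r₀) (hU : Measurable U)
    (hunif : pdf.IsUniform U (Metric.closedBall 0 r₀) μ) {f : ℝ → ℝ} (hf : Measurable f) :
    ∫ ω, f ‖U ω‖ ∂μ = 2 / r₀ ^ 2 * ∫ r in (0 : ℝ)..r₀, f r * r := by
  have h0 : ∫ ω, f ‖U ω‖ ∂μ = ∫ x, f ‖x‖ ∂(μ.map U) := by
    rw [integral_map hU.aemeasurable]
    exact (hf.comp measurable_norm).aestronglyMeasurable
  have hS : MeasurableSet (Metric.closedBall (0 : Plane) r₀) := measurableSet_closedBall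
  rw [h0, show μ.map U = _ from hunif, ProbabilityTheory.cond, integral_smul_measure,
    ← integral_indicator hS]
  have h1 : (fun x : Plane => Set.indicator (Metric.closedBall (0 : Plane) r₀)
      (fun x => f ‖x‖) x) = fun x => (fun r : ℝ => Set.indicator (Set.Iic r₀) f r) ‖x‖ := by
    funext z
    simp [Set.indicator]
  rw [h1, integral_fun_norm_addHaar]
  have h2 : ∫ y in Set.Ioi (0 : ℝ), y ^ (Module.finrank ℝ Plane - 1) •
      (Set.indicator (Set.Iic r₀) f y) = ∫ r in (0 : ℝ)..r₀, f r * r := by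
    rw [intervalIntegral.integral_of_le hr.le, ← integral_indicator measurableSet_Ioc,
      ← integral_indicator measurableSet_Ioi]
    congr 1
    funext r
    by_cases h : 0 < r <;> by_cases h' : r ≤ r₀ <;> simp [Set.indicator, h, h', mul_comm]
  rw [h2]
  simp [measureReal_def, EuclideanSpace.volume_ball_fin_two,
    EuclideanSpace.volume_closedBall_fin_two, hr.le]
  field_simp

theorem norm_div_lt_iff (p : NOMAParams) (u : Plane) (z : ℂ) (y : ℝ) :
    ‖z‖ ^ 2 / (1 + ‖u‖ ^ p.α) < y ↔ ‖z‖ ^ 2 < (1 + ‖u‖ ^ p.α) * y := by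
  rw [div_lt_iff₀' (by positivity)]

namespace NOMANetwork

variable {p : NOMAParams} {Ω : Type*} [MeasurableSpace Ω] {μ : Measure Ω} (N : NOMANetwork p μ)

theorem measurable_gain (i : Fin p.M) : Measurable fun ω => N.gain ω i := by
  have := N.measurable_U i
  have := N.measurable_G i
  unfold gain
  fun_prop

theorem indep_user [IsProbabilityMeasure μ] (i : Fin p.M) : IndepFun (N.U i) (N.G i) μ :=
  N.indep_users.comp (measurable_pi_apply i) (measurable_pi_apply i)

theorem real_gain_lt [IsProbabilityMeasure μ] (i : Fin p.M) {y : ℝ} (hy : 0 ≤ y) :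
    μ.real {ω | N.gain ω i < y} = p.cdfU y := by
  have hU := N.measurable_U i
  have hG := N.measurable_G i
  have hS : MeasurableSet {x : Plane × ℂ | ‖x.2‖ ^ 2 / (1 + ‖x.1‖ ^ p.α) < y} :=
    measurableSet_lt (by fun_prop) measurable_const
  have h := measureReal_mem_of_indepFun hU hG (N.indep_user i) hS
  have h1 : ∀ u : Plane, μ.real {ω | ‖N.G i ω‖ ^ 2 / (1 + ‖u‖ ^ p.α) < y} =
      1 - Real.exp (-((1 + ‖u‖ ^ p.α) * y)) := by
    intro u
    have h2 : 0 ≤ (1 + ‖u‖ ^ p.α) * y := by positivity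
    rw [← complexGaussian_real_norm_sq_lt h2, ← N.law_G i, measureReal_def, measureReal_def,
      Measure.map_apply hG (measurableSet_lt (by fun_prop) measurable_const)]
    simp only [norm_div_lt_iff]
    rfl
  simp only [Set.mem_ofPred_eq, h1] at h
  rw [show {ω | N.gain ω i < y} = {ω | ‖N.G i ω‖ ^ 2 / (1 + ‖N.U i ω‖ ^ p.α) < y} from rfl, h,
    integral_norm_of_isUniform_closedBall (f := fun r => 1 - Real.exp (-((1 + r ^ p.α) * y)))
      p.RD_pos hU (N.uniform_U i) (by fun_prop)]
  rfl

end NOMANetwork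

/-! ### Order statistics and the law of the ordered gain -/

/-- Sorting permutes the indices and so preserves the number of entries below `y`; in a monotone
list these form an initial segment. -/
theorem orderStat_lt_iff {M : ℕ} (v : Fin M → ℝ) (k : Fin M) (y : ℝ) :
    orderStat v k < y ↔ (k : ℕ) < (Finset.univ.filter fun i => v i < y).card := by
  rw [orderStat, show v (Tuple.sort v k) = (v ∘ Tuple.sort v) k from rfl,
    ← Tuple.lt_card_lt_iff_apply_lt_of_monotone (Tuple.monotone_sort v)]
  have : (Finset.univ.filter fun i => v i < y).card =
      (Finset.univ.filter fun i => (v ∘ Tuple.sort v) i < y).card :=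
    (Finset.card_equiv (Tuple.sort v) (by simp)).symm
  rw [this]

/-- The derivative of a Bernstein polynomial is a difference of two consecutive ones of lower
degree, so the sum telescopes. -/
theorem sum_bernstein_tail_derivative (N k : ℕ) :
    Polynomial.derivative (∑ j ∈ Finset.Ioc k (N + 1), bernsteinPolynomial ℝ (N + 1) j) =
      (N + 1 : Polynomial ℝ) * bernsteinPolynomial ℝ N k := by
  have key : ∀ n, k ≤ n → Polynomial.derivative (∑ j ∈ Finset.Ioc k n,
      bernsteinPolynomial ℝ (N + 1) j) = (N + 1 : Polynomial ℝ) *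
        (bernsteinPolynomial ℝ N k - bernsteinPolynomial ℝ N n) := by
    intro n hn
    induction n, hn using Nat.le_induction with
    | base => simp
    | succ n hn ih =>
      rw [← Finset.insert_Ioc_right_eq_Ioc_add_one hn, Finset.sum_insert (by simp),
        Polynomial.derivative_add, ih, bernsteinPolynomial.derivative_succ]
      simp
      ring
  rcases le_or_gt k (N + 1) with h | h
  · rw [key _ h, bernsteinPolynomial.eq_zero_of_lt ℝ (Nat.lt_succ_self N), sub_zero]
  · rw [Finset.Ioc_eq_empty (by omega), bernsteinPolynomial.eq_zero_of_lt ℝ (by omega)]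
    simp

/-- Both sides vanish at 0 and have the same derivative, a multiple of `x ^ k * (1 - x) ^ (N - k)`:
on the left by telescoping, on the right after the binomial expansion of the second factor. -/
theorem sum_bernstein_tail_eval (N k : ℕ) (x : ℝ) :
    ∑ j ∈ Finset.Ioc k (N + 1), ((N + 1).choose j : ℝ) * x ^ j * (1 - x) ^ (N + 1 - j) =
      (N + 1) * N.choose k * ∑ l ∈ Finset.range (N - k + 1),
        ((N - k).choose l : ℝ) * ((-1) ^ l / (k + 1 + l : ℝ)) * x ^ (k + 1 + l) := by
  have h1 : ∀ x : ℝ, HasDerivAt (fun x => ∑ j ∈ Finset.Ioc k (N + 1),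
      ((N + 1).choose j : ℝ) * x ^ j * (1 - x) ^ (N + 1 - j))
      ((N + 1) * (N.choose k * x ^ k * (1 - x) ^ (N - k))) x := by
    intro x
    have h := (∑ j ∈ Finset.Ioc k (N + 1), bernsteinPolynomial ℝ (N + 1) j).hasDerivAt x
    rw [sum_bernstein_tail_derivative] at h
    simpa [Polynomial.eval_finsetSum, bernsteinPolynomial] using h
  have h2 : ∀ x : ℝ, HasDerivAt (fun x => (N + 1) * N.choose k *
      ∑ l ∈ Finset.range (N - k + 1),
        ((N - k).choose l : ℝ) * ((-1) ^ l / (k + 1 + l : ℝ)) * x ^ (k + 1 + l))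
      ((N + 1) * (N.choose k * x ^ k * (1 - x) ^ (N - k))) x := by
    intro x
    have h : HasDerivAt (fun x : ℝ => ∑ l ∈ Finset.range (N - k + 1),
        ((N - k).choose l : ℝ) * ((-1) ^ l / (k + 1 + l : ℝ)) * x ^ (k + 1 + l))
        (∑ l ∈ Finset.range (N - k + 1),
          ((N - k).choose l : ℝ) * ((-1) ^ l / (k + 1 + l : ℝ)) *
            ((k + 1 + l : ℕ) * x ^ (k + 1 + l - 1))) x :=
      HasDerivAt.fun_sum fun l _ => (hasDerivAt_pow _ x).const_mul _
    refine (h.const_mul _).congr_deriv ?_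
    rw [mul_assoc, mul_assoc, sub_eq_neg_add, add_pow]
    congr 2
    rw [Finset.mul_sum]
    refine Finset.sum_congr rfl fun l hl => ?_
    have : (k + 1 + l : ℝ) ≠ 0 := by positivity
    rw [show k + 1 + l - 1 = k + l by omega, pow_add, neg_pow x]
    push_cast
    field_simp
    simp
  have h3 := is_const_of_deriv_eq_zero (fun x => ((h1 x).sub (h2 x)).differentiableAt)
    (fun x => by rw [((h1 x).sub (h2 x)).deriv, sub_self]) x 0
  simp only [Pi.sub_apply] at h3
  have h4 : ∑ j ∈ Finset.Ioc k (N + 1),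
      ((N + 1).choose j : ℝ) * (0 : ℝ) ^ j * (1 - 0) ^ (N + 1 - j) = 0 :=
    Finset.sum_eq_zero fun j hj => by
      rw [Finset.mem_Ioc] at hj
      simp [show j ≠ 0 by omega]
  rw [h4] at h3
  simpa [sub_eq_zero] using h3

/-- The event splits according to the exact set `S` of indices whose value lies below `y`.
Independence gives each piece a probability depending only on the size of `S`, and grouping by size
gives the binomial tail. -/
theorem real_lt_card_of_iIndepFun {Ω : Type*} [MeasurableSpace Ω] {μ : Measure Ω}
    [IsProbabilityMeasure μ] {M : ℕ} {v : Fin M → Ω → ℝ} (hv : ∀ i, Measurable (v i))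
    (hind : iIndepFun v μ) {y q : ℝ} (hq : ∀ i, μ.real {ω | v i ω < y} = q) (k : ℕ) :
    μ.real {ω | k < (Finset.univ.filter fun i => v i ω < y).card} =
      ∑ j ∈ Finset.Ioc k M, (M.choose j : ℝ) * q ^ j * (1 - q) ^ (M - j) := by
  have hT : ∀ S : Finset (Fin M), {ω | (Finset.univ.filter fun i => v i ω < y) = S} =
      ⋂ i ∈ (Finset.univ : Finset (Fin M)), v i ⁻¹' (if i ∈ S then Set.Iio y else Set.Ici y) := by
    intro S
    ext ω
    simp only [Set.mem_ofPred_eq, Finset.ext_iff, Finset.mem_filter, Finset.mem_univ, true_and,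
      Set.mem_iInter, Set.mem_preimage]
    refine ⟨fun h i _ => ?_, fun h i => ?_⟩
    · split_ifs with hi
      · exact (h i).2 hi
      · exact not_lt.1 fun h' => hi ((h i).1 h')
    · have := h i trivial
      split_ifs at this with hi
      · simpa [hi] using this
      · simpa [hi] using this
  have hset : ∀ (S : Finset (Fin M)) i,
      MeasurableSet (if i ∈ S then Set.Iio y else Set.Ici y : Set ℝ) := by
    intro S i
    split_ifs <;> measurability
  have hm : ∀ S : Finset (Fin M), MeasurableSet
      {ω | (Finset.univ.filter fun i => v i ω < y) = S} := by
    intro S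
    rw [hT]
    exact Finset.measurableSet_biInter _ fun i _ => hv i (hset S i)
  have hP : ∀ S : Finset (Fin M), μ.real {ω | (Finset.univ.filter fun i => v i ω < y) = S} =
      q ^ S.card * (1 - q) ^ (M - S.card) := by
    intro S
    rw [hT, measureReal_def, hind.measure_inter_preimage_eq_mul _ fun i _ => hset S i,
      ENNReal.toReal_prod]
    have : ∀ i, (μ (v i ⁻¹' (if i ∈ S then Set.Iio y else Set.Ici y))).toReal =
        if i ∈ S then q else 1 - q := by
      intro i
      split_ifs with hi
      · exact hq i
      · rw [← hq i, ← measureReal_def, show {ω | v i ω < y} = v i ⁻¹' Set.Iio y from rfl,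
          ← probReal_compl_eq_one_sub (hv i measurableSet_Iio)]
        congr 1
        ext ω
        simp
    simp only [this]
    rw [Finset.prod_ite]
    simp only [Finset.prod_const]
    congr 2
    · simp
    · rw [Finset.filter_not, Finset.card_sdiff]
      simp
  have hU : {ω | k < (Finset.univ.filter fun i => v i ω < y).card} =
      ⋃ S ∈ (Finset.univ : Finset (Finset (Fin M))).filter (fun S => k < S.card),
        {ω | (Finset.univ.filter fun i => v i ω < y) = S} := by
    ext ω
    simp
  rw [hU, measureReal_biUnion_finset _ fun S _ => hm S]
  · simp only [hP]
    rw [Finset.sum_filter, ← Finset.powerset_univ,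
      Finset.sum_powerset_apply_card
        (fun j => if k < j then q ^ j * (1 - q) ^ (M - j) else 0),
      Finset.card_univ, Fintype.card_fin]
    simp only [smul_ite, smul_zero, nsmul_eq_mul]
    rw [← Finset.sum_filter]
    refine Finset.sum_congr ?_ fun j _ => by ring
    ext j
    simp
    omega
  · intro S _ S' _ hne
    rw [Function.onFun, Set.disjoint_left]
    intro ω h h'
    exact hne (h.symm.trans h')

namespace NOMANetwork

variable {p : NOMAParams} {Ω : Type*} [MeasurableSpace Ω] {μ : Measure Ω} (N : NOMANetwork p μ)

/-- The joint law of all positions and all fadings is a product of two products; regrouping the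
factors user by user makes the pairs independent. -/
theorem iIndepFun_gain [IsProbabilityMeasure μ] : iIndepFun (fun i ω => N.gain ω i) μ := by
  have hU := N.measurable_U
  have hG := N.measurable_G
  have hP : ∀ i, IsProbabilityMeasure (μ.map (N.U i)) := fun i =>
    Measure.isProbabilityMeasure_map (hU i).aemeasurable
  have hP' : ∀ i, IsProbabilityMeasure (μ.map (N.G i)) := fun i =>
    Measure.isProbabilityMeasure_map (hG i).aemeasurable
  have h : iIndepFun (fun i ω => (N.U i ω, N.G i ω)) μ := by
    rw [iIndepFun_iff_map_fun_eq_pi_map (fun i => ((hU i).prodMk (hG i)).aemeasurable)]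
    have h1 : (μ.map fun ω => ((fun i => N.U i ω), (fun i => N.G i ω))) =
        (Measure.pi fun i => μ.map (N.U i)).prod (Measure.pi fun i => μ.map (N.G i)) := by
      rw [← N.indep_U.map_fun_eq_pi_map fun i => (hU i).aemeasurable,
        ← N.indep_G.map_fun_eq_pi_map fun i => (hG i).aemeasurable]
      exact (indepFun_iff_map_prod_eq_prod_map_map (by fun_prop) (by fun_prop)).1 N.indep_users
    have h2 : ∀ i, μ.map (fun ω => (N.U i ω, N.G i ω)) = (μ.map (N.U i)).prod (μ.map (N.G i)) :=
      fun i => (indepFun_iff_map_prod_eq_prod_map_map (by fun_prop) (by fun_prop)).1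
        (N.indep_user i)
    simp only [h2]
    have h3 := ((measurePreserving_arrowProdEquivProdArrow Plane ℂ (Fin p.M)
      (fun i => μ.map (N.U i)) (fun i => μ.map (N.G i))).symm _).map_eq
    rw [← h3, ← h1, Measure.map_map (MeasurableEquiv.measurable _) (by fun_prop)]
    rfl
  exact h.comp (fun _ x => ‖x.2‖ ^ 2 / (1 + ‖x.1‖ ^ p.α)) fun _ => by fun_prop

theorem real_gainm_lt [IsProbabilityMeasure μ] {y : ℝ} (hy : 0 ≤ y) :
    μ.real {ω | N.gainm ω < y} = p.cdfOrd p.cdfU y := by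
  have h := real_lt_card_of_iIndepFun (fun i => N.measurable_gain i) N.iIndepFun_gain
    (fun i => N.real_gain_lt i hy) p.rankm
  simp only [gainm, orderStat_lt_iff]
  rw [h]
  have h1 := p.one_le_m
  have h2 := p.m_lt_n
  have h3 := p.n_le_M
  -- The Bernstein identity uses the 0-based rank `k = m - 1` and `N = M - 1`, so that `(N + 1) *
  -- N.choose k` becomes `φ`.
  obtain ⟨n, hn⟩ : ∃ n, p.M = n + 1 := ⟨p.M - 1, by omega⟩
  obtain ⟨k, hk⟩ : ∃ k, p.m = k + 1 := ⟨p.m - 1, by omega⟩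
  have hr : ((p.rankm : Fin p.M) : ℕ) = k := by simp [NOMAParams.rankm, hk]
  rw [hr, NOMAParams.cdfOrd, NOMAParams.φ, hn, hk, sum_bernstein_tail_eval n k]
  congr 1
  · rw [Nat.cast_choose ℝ (show k ≤ n by omega), Nat.factorial_succ]
    simp
    ring
  · simp

theorem measurable_gainm : Measurable N.gainm := by
  refine measurable_of_Iio fun y => ?_
  have : N.gainm ⁻¹' Set.Iio y = {ω | (p.rankm : ℕ) < ∑ i, if N.gain ω i < y then 1 else 0} := by
    ext ω
    simp [gainm, orderStat_lt_iff]
  rw [this]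
  refine measurableSet_lt measurable_const (Finset.measurable_sum _ fun i _ => ?_)
  exact Measurable.ite (measurableSet_lt (N.measurable_gain i) measurable_const)
    measurable_const measurable_const

theorem gainm_nonneg (ω : Ω) : 0 ≤ N.gainm ω := by
  unfold gainm orderStat gain
  positivity

end NOMANetwork

/-! ### Poisson counts and the void probability for finitely many cells -/

theorem measurable_setOf_mem {Ω : Type*} [MeasurableSpace Ω] {A : ℕ → Set Ω}
    (hA : ∀ e, MeasurableSet (A e)) : Measurable fun ω => {e | ω ∈ A e} :=
  measurable_set_iff.2 fun e => measurableSet_setOfPred.1 (hA e)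

namespace IsHomogeneousPPP

variable {Ω : Type*} [MeasurableSpace Ω] {μ : Measure Ω} [IsProbabilityMeasure μ]
  {X : ℕ → Ω → Plane} {lam : ℝ}

/-- The Poisson weights over the finite counts already sum to one, so an infinite count has
probability zero. -/
theorem ae_finite (h : IsHomogeneousPPP X lam μ) (hl : 0 ≤ lam) {B : Set Plane}
    (hB : MeasurableSet B) (hb : Bornology.IsBounded B) :
    ∀ᵐ ω ∂μ, {e | X e ω ∈ B}.Finite := by
  have hm : ∀ k : ℕ, MeasurableSet {ω | {e | X e ω ∈ B}.encard = (k : ℕ∞)} := fun k =>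
    (measurable_encard.comp (measurable_setOf_mem fun e => h.1 e hB)) (measurableSet_singleton _)
  have hk : ∀ k : ℕ, μ {ω | {e | X e ω ∈ B}.encard = (k : ℕ∞)} =
      ENNReal.ofReal (Real.exp (-(lam * volume.real B).toNNReal) *
        (lam * volume.real B).toNNReal ^ k / k.factorial) := by
    intro k
    have h1 := h.2 1 (fun _ => B) (fun _ => hB) (fun _ => hb)
      (fun i j hij => absurd (Subsingleton.elim i j) hij) (fun _ => k)
    rw [← ofReal_measureReal, Real.coe_toNNReal _ (by positivity)]
    simpa using congrArg ENNReal.ofReal h1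
  have hU : μ (⋃ k : ℕ, {ω | {e | X e ω ∈ B}.encard = (k : ℕ∞)}) = 1 := by
    rw [measure_iUnion ?_ hm]
    · simp only [hk]
      rw [← ENNReal.ofReal_tsum_of_nonneg (fun k => by positivity)
        (hasSum_one_poissonMeasure _).summable, (hasSum_one_poissonMeasure _).tsum_eq,
        ENNReal.ofReal_one]
    · intro i j hij
      rw [Function.onFun, Set.disjoint_left]
      intro ω h1 h2
      exact hij (by exact_mod_cast h1.symm.trans h2)
  have := (mem_ae_iff_prob_eq_one
    (MeasurableSet.iUnion hm)).2 hU
  filter_upwards [this] with ω hω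
  obtain ⟨k, hk⟩ := Set.mem_iUnion.1 hω
  exact Set.finite_of_encard_eq_coe hk

theorem map_ncard (h : IsHomogeneousPPP X lam μ) (hl : 0 ≤ lam) {r : ℕ} {B : Fin r → Set Plane}
    (hB : ∀ j, MeasurableSet (B j)) (hb : ∀ j, Bornology.IsBounded (B j))
    (hd : Pairwise fun i j => Disjoint (B i) (B j)) :
    μ.map (fun ω j => {e | X e ω ∈ B j}.ncard) =
      Measure.pi fun j => poissonMeasure (lam * volume.real (B j)).toNNReal := by
  refine Measure.ext_of_singleton fun k => ?_
  have hm : Measurable (fun ω j => {e | X e ω ∈ B j}.ncard) :=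
    measurable_pi_lambda _ fun j =>
      measurable_ncard.comp (measurable_setOf_mem fun e => h.1 e (hB j))
  rw [Measure.map_apply hm (measurableSet_singleton _), Measure.pi_singleton]
  have h1 := h.2 r B hB hb hd k
  have h2 : μ ((fun ω j => {e | X e ω ∈ B j}.ncard) ⁻¹' {k}) =
      μ {ω | ∀ j, {e | X e ω ∈ B j}.encard = (k j : ℕ∞)} := by
    refine measure_congr ?_
    have := ae_all_iff.2 fun j => h.ae_finite hl (hB j) (hb j)
    filter_upwards [this] with ω hω
    apply propext
    change (fun j => {e | X e ω ∈ B j}.ncard) = k ↔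
      ∀ j, {e | X e ω ∈ B j}.encard = (k j : ℕ∞)
    rw [funext_iff]
    refine forall_congr' fun j => ?_
    rw [← (hω j).cast_ncard_eq]
    norm_cast
  rw [h2, ← ofReal_measureReal, h1, ENNReal.ofReal_prod_of_nonneg fun j _ => by positivity]
  refine Finset.prod_congr rfl fun j _ => ?_
  rw [poissonMeasure_singleton, Real.coe_toNNReal _ (by positivity)]

/-- The counts are independent Poisson variables, so this is a product of Poisson generating
functions, each an exponential series. -/
theorem integral_prod_pow_ncard (h : IsHomogeneousPPP X lam μ) (hl : 0 ≤ lam) {r : ℕ}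
    {B : Fin r → Set Plane} (hB : ∀ j, MeasurableSet (B j))
    (hb : ∀ j, Bornology.IsBounded (B j)) (hd : Pairwise fun i j => Disjoint (B i) (B j))
    (q : Fin r → ℝ) :
    ∫ ω, ∏ j, q j ^ {e | X e ω ∈ B j}.ncard ∂μ =
      ∏ j, Real.exp (-(lam * volume.real (B j) * (1 - q j))) := by
  have hm : Measurable (fun ω j => {e | X e ω ∈ B j}.ncard) :=
    measurable_pi_lambda _ fun j =>
      measurable_ncard.comp (measurable_setOf_mem fun e => h.1 e (hB j))
  have h1 := integral_map (μ := μ) hm.aemeasurable (f := fun n : Fin r → ℕ => ∏ j, q j ^ n j)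
    (measurable_of_countable _).aestronglyMeasurable
  rw [← h1, h.map_ncard hl hB hb hd, integral_fintype_prod_eq_prod (fun j n => q j ^ n)]
  refine Finset.prod_congr rfl fun j _ => ?_
  rw [integral_poissonMeasure]
  have h0 : (0 : ℝ) ≤ lam * volume.real (B j) := by positivity
  rw [Real.coe_toNNReal _ h0]
  have h3 : ∀ n : ℕ, (Real.exp (-(lam * volume.real (B j))) *
      (lam * volume.real (B j)) ^ n / n.factorial) • q j ^ n =
      Real.exp (-(lam * volume.real (B j))) *
        ((lam * volume.real (B j) * q j) ^ n / n.factorial) := fun n => by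
    rw [smul_eq_mul, mul_pow]
    ring
  simp only [h3]
  rw [tsum_mul_left, ← congrFun NormedSpace.exp_eq_tsum_div, ← Real.exp_eq_exp_ℝ, ← Real.exp_add]
  congr 1
  ring

end IsHomogeneousPPP

namespace NOMANetwork

variable {p : NOMAParams} {Ω : Type*} [MeasurableSpace Ω] {μ : Measure Ω} (N : NOMANetwork p μ)

theorem real_g_norm_sq_le (e : ℕ) {t : ℝ} (ht : 0 ≤ t) :
    μ.real (N.g e ⁻¹' {z | ‖z‖ ^ 2 ≤ t}) = 1 - Real.exp (-t) := by
  rw [← complexGaussian_real_norm_sq_le ht, ← N.law_g e, measureReal_def, measureReal_def,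
    Measure.map_apply (N.measurable_g e) (measurableSet_le (by fun_prop) measurable_const)]

/-- The index sets `S j` play the role of the points in each cell for frozen positions. Disjointness
means that each fading coefficient meets at most one constraint, so independence yields one factor
per point. -/
theorem real_forall_g_norm_sq_le [IsProbabilityMeasure μ] {r : ℕ} {S : Fin r → Set ℕ}
    (hS : ∀ j, (S j).Finite) (hd : Pairwise fun i j => Disjoint (S i) (S j)) {t : Fin r → ℝ}
    (ht : ∀ j, 0 ≤ t j) :
    μ.real {ω | ∀ j, ∀ e ∈ S j, ‖N.g e ω‖ ^ 2 ≤ t j} =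
      ∏ j, (1 - Real.exp (-t j)) ^ (S j).ncard := by
  classical
  have h1 : {ω | ∀ j, ∀ e ∈ S j, ‖N.g e ω‖ ^ 2 ≤ t j} =
      ⋂ e ∈ Finset.univ.biUnion (fun j => (hS j).toFinset),
        N.g e ⁻¹' {z | ∀ j, e ∈ S j → ‖z‖ ^ 2 ≤ t j} := by
    ext ω
    simp only [Set.mem_ofPred_eq, Set.mem_iInter, Set.mem_preimage, Finset.mem_biUnion,
      Finset.mem_univ, true_and, Set.Finite.mem_toFinset]
    exact ⟨fun h e _ j hj => h j e hj, fun h j e he => h e ⟨j, he⟩ j he⟩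
  have hmeas : ∀ e, MeasurableSet {z : ℂ | ∀ j, e ∈ S j → ‖z‖ ^ 2 ≤ t j} := by
    intro e
    have : {z : ℂ | ∀ j, e ∈ S j → ‖z‖ ^ 2 ≤ t j} =
        ⋂ j, ⋂ _ : e ∈ S j, {z : ℂ | ‖z‖ ^ 2 ≤ t j} := by
      ext z
      simp
    rw [this]
    exact MeasurableSet.iInter fun j => MeasurableSet.iInter fun _ =>
      measurableSet_le (by fun_prop) measurable_const
  have hdis : ((Finset.univ : Finset (Fin r)) : Set (Fin r)).PairwiseDisjoint
      fun j => (hS j).toFinset := by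
    intro i _ j _ hij
    simpa [Function.onFun, Set.Finite.disjoint_toFinset] using hd hij
  rw [h1, measureReal_def, N.indep_g.measure_inter_preimage_eq_mul _ fun e _ => hmeas e,
    ENNReal.toReal_prod, Finset.prod_biUnion hdis]
  refine Finset.prod_congr rfl fun j _ => ?_
  rw [Set.ncard_eq_toFinset_card _ (hS j), ← Finset.prod_const]
  refine Finset.prod_congr rfl fun e he => ?_
  rw [← N.real_g_norm_sq_le e (ht j), ← measureReal_def]
  congr 2
  ext z
  have hej : e ∈ S j := by simpa using he
  refine ⟨fun h => h j hej, fun h i hi => ?_⟩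
  rcases eq_or_ne i j with rfl | hij
  · exact h
  · exact absurd hej (Set.disjoint_left.1 (hd hij) hi)

/-- Conditioning on the positions leaves a product of powers with bases `1 - exp (-t j)`; in the
generating function `1 - q` becomes `exp (-t j)`. -/
theorem real_forall_eve_le [IsProbabilityMeasure μ] {r : ℕ} {B : Fin r → Set Plane}
    (hB : ∀ j, MeasurableSet (B j)) (hb : ∀ j, Bornology.IsBounded (B j))
    (hd : Pairwise fun i j => Disjoint (B i) (B j)) {t : Fin r → ℝ} (ht : ∀ j, 0 ≤ t j) :
    μ.real {ω | ∀ j e, N.X e ω ∈ B j → ‖N.g e ω‖ ^ 2 ≤ t j} =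
      Real.exp (-(p.lam * ∑ j, volume.real (B j) * Real.exp (-t j))) := by
  have hX := N.ppp_X.1
  have hg := N.measurable_g
  have hS : MeasurableSet {x : (ℕ → Plane) × (ℕ → ℂ) |
      ∀ j e, x.1 e ∈ B j → ‖x.2 e‖ ^ 2 ≤ t j} := by
    have : {x : (ℕ → Plane) × (ℕ → ℂ) | ∀ j e, x.1 e ∈ B j → ‖x.2 e‖ ^ 2 ≤ t j} =
        ⋂ j, ⋂ e, ({x | x.1 e ∈ B j}ᶜ ∪ {x | ‖x.2 e‖ ^ 2 ≤ t j}) := by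
      ext x
      simp [imp_iff_not_or]
    rw [this]
    refine MeasurableSet.iInter fun j => MeasurableSet.iInter fun e => ?_
    refine MeasurableSet.union (MeasurableSet.compl ?_)
      (measurableSet_le (by fun_prop) measurable_const)
    exact (show Measurable fun x : (ℕ → Plane) × (ℕ → ℂ) => x.1 e by fun_prop) (hB j)
  have h := measureReal_mem_of_indepFun (by fun_prop) (by fun_prop) N.indep_eves hS
  simp only [Set.mem_ofPred_eq] at h
  rw [h]
  have h2 : ∀ᵐ ω ∂μ, μ.real {ω' | ∀ j e, N.X e ω ∈ B j → ‖N.g e ω'‖ ^ 2 ≤ t j} =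
      ∏ j, (1 - Real.exp (-t j)) ^ {e | N.X e ω ∈ B j}.ncard := by
    have := ae_all_iff.2 fun j => N.ppp_X.ae_finite p.lam_pos.le (hB j) (hb j)
    filter_upwards [this] with ω hω
    refine N.real_forall_g_norm_sq_le hω (fun i j hij => ?_) ht
    refine Set.disjoint_left.2 fun e h1 h2 => ?_
    exact Set.disjoint_left.1 (hd hij) h1 h2
  rw [integral_congr_ae h2, N.ppp_X.integral_prod_pow_ncard p.lam_pos.le hB hb hd,
    ← Real.exp_sum, Finset.sum_neg_distrib, Finset.mul_sum]
  congr 2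
  refine Finset.sum_congr rfl fun j _ => ?_
  ring

end NOMANetwork

/-! ### From thin rings to an integral over an annulus -/

/-- In the variable `v = ‖x‖²` planar area is `π dv`, so equal steps in `v` give rings of equal
area. -/
theorem volume_real_annulus {a b : ℝ} (ha : 0 ≤ a) (hab : a ≤ b) :
    volume.real {x : Plane | a ≤ ‖x‖ ^ 2 ∧ ‖x‖ ^ 2 < b} = Real.pi * (b - a) := by
  have h : {x : Plane | a ≤ ‖x‖ ^ 2 ∧ ‖x‖ ^ 2 < b} =
      Metric.ball 0 √b \ Metric.ball 0 √a := by
    ext x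
    simp [Real.lt_sqrt (norm_nonneg x), and_comm]
  have hv : ∀ c : ℝ, 0 ≤ c → volume.real (Metric.ball (0 : Plane) √c) = Real.pi * c := by
    intro c hc
    rw [measureReal_def, EuclideanSpace.volume_ball_fin_two, ENNReal.toReal_mul,
      ENNReal.toReal_pow, ENNReal.toReal_ofReal (Real.sqrt_nonneg _),
      ENNReal.toReal_ofReal Real.pi_pos.le, Real.sq_sqrt hc, mul_comm]
  rw [h, measureReal_sdiff (Metric.ball_subset_ball (Real.sqrt_le_sqrt hab)) measurableSet_ball
    (measure_ball_lt_top.ne), hv a ha, hv b (ha.trans hab)]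
  ring

theorem AntitoneOn.mul_sum_range_bounds {f : ℝ → ℝ} {a T : ℝ} (hT : 0 < T)
    (hf : AntitoneOn f (Set.Icc a (a + T))) {n : ℕ} (hn : 0 < n) :
    T / n * ∑ i ∈ Finset.range n, f (a + T / n * (i + 1 : ℕ)) ≤ ∫ v in a..a + T, f v ∧
      ∫ v in a..a + T, f v ≤ T / n * ∑ i ∈ Finset.range n, f (a + T / n * i) := by
  have hn' : (0 : ℝ) < n := by exact_mod_cast hn
  have hh : 0 < T / n := by positivity
  have hg : AntitoneOn (fun u => f (a + T / n * u)) (Set.Icc (0 : ℝ) (0 + n)) := by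
    have hmem : ∀ u ∈ Set.Icc (0 : ℝ) (0 + n), a + T / n * u ∈ Set.Icc a (a + T) := by
      intro u hu
      have h1 : T / n * u ≤ T / n * n := mul_le_mul_of_nonneg_left (by simpa using hu.2) hh.le
      rw [div_mul_cancel₀ _ hn'.ne'] at h1
      have := mul_nonneg hh.le hu.1
      exact ⟨by linarith, by linarith⟩
    intro u hu w hw huw
    exact hf (hmem u hu) (hmem w hw) (by gcongr)
  have hI : ∫ v in a..a + T, f v = T / n * ∫ u in (0 : ℝ)..0 + n, f (a + T / n * u) := by
    rw [intervalIntegral.mul_integral_comp_add_mul]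
    congr 1
    · simp
    · field_simp
      ring
  rw [hI]
  have h1 := hg.sum_le_integral
  have h2 := hg.integral_le_sum
  simp only [zero_add] at h1 h2 ⊢
  exact ⟨mul_le_mul_of_nonneg_left h1 hh.le, mul_le_mul_of_nonneg_left h2 hh.le⟩

theorem rpow_norm_eq {α : ℝ} (x : Plane) : ‖x‖ ^ α = (‖x‖ ^ 2) ^ (α / 2) := by
  rw [← Real.rpow_natCast, ← Real.rpow_mul (norm_nonneg x)]
  congr 1
  push_cast
  ring

theorem antitoneOn_exp_neg_mul_rpow {s β : ℝ} (hs : 0 ≤ s) (hβ : 0 ≤ β) :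
    AntitoneOn (fun v : ℝ => Real.exp (-(s * v ^ β))) (Set.Ici 0) := by
  intro u hu w _ huw
  have : u ^ β ≤ w ^ β := Real.rpow_le_rpow hu huw hβ
  simp only [Real.exp_le_exp, neg_le_neg_iff]
  gcongr

namespace NOMANetwork

variable {p : NOMAParams} {Ω : Type*} [MeasurableSpace Ω] {μ : Measure Ω} (N : NOMANetwork p μ)

/-- The threshold increases with the distance. Freezing it at the inner or outer edge of each of `n`
rings bounds the event from inside or outside, and both bounds converge to the same exponential. -/
theorem real_eve_le_annulus [IsProbabilityMeasure μ] {s T : ℝ} (hs : 0 < s) (hT : 0 < T) :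
    μ.real {ω | ∀ e, p.rp ^ 2 ≤ ‖N.X e ω‖ ^ 2 → ‖N.X e ω‖ ^ 2 < p.rp ^ 2 + T →
      ‖N.g e ω‖ ^ 2 ≤ s * ‖N.X e ω‖ ^ p.α} =
    Real.exp (-(p.lam * Real.pi *
      ∫ v in p.rp ^ 2..p.rp ^ 2 + T, Real.exp (-(s * v ^ (p.α / 2))))) := by
  set f : ℝ → ℝ := fun v => Real.exp (-(s * v ^ (p.α / 2))) with hf
  set J := ∫ v in p.rp ^ 2..p.rp ^ 2 + T, f v with hJ
  set Q := {ω | ∀ e, p.rp ^ 2 ≤ ‖N.X e ω‖ ^ 2 → ‖N.X e ω‖ ^ 2 < p.rp ^ 2 + T →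
      ‖N.g e ω‖ ^ 2 ≤ s * ‖N.X e ω‖ ^ p.α} with hQ
  have hα := p.α_pos
  have hlam := p.lam_pos
  have hanti : AntitoneOn f (Set.Ici 0) := antitoneOn_exp_neg_mul_rpow hs.le (by positivity)
  have key : ∀ n : ℕ, 0 < n → Real.exp (-(p.lam * Real.pi * (J + T / n))) ≤ μ.real Q ∧
      μ.real Q ≤ Real.exp (-(p.lam * Real.pi * (J - T / n))) := by
    intro n hn
    have hn' : (0 : ℝ) < n := by exact_mod_cast hn
    set h := T / n with hh
    have hh0 : 0 < h := by positivity
    obtain ⟨hlow, hupp⟩ := AntitoneOn.mul_sum_range_bounds hT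
      (hanti.mono fun v hv => (sq_nonneg p.rp).trans hv.1) hn
    rw [← hJ, ← hh] at hlow hupp
    set a : ℕ → ℝ := fun i => p.rp ^ 2 + h * i with ha
    have ha0 : ∀ i, 0 ≤ a i := fun i => by positivity
    have hstep : ∀ i, a (i + 1) - a i = h := fun i => by simp [ha]; ring
    set B : Fin n → Set Plane := fun i => {x | a i ≤ ‖x‖ ^ 2 ∧ ‖x‖ ^ 2 < a (i + 1)} with hBdef
    have hB : ∀ j, MeasurableSet (B j) := fun j => by
      have h1 : Measurable fun x : Plane => ‖x‖ ^ 2 := by fun_prop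
      exact (measurableSet_le measurable_const h1).inter (measurableSet_lt h1 measurable_const)
    have hb : ∀ j, Bornology.IsBounded (B j) := fun j => by
      refine (Metric.isBounded_ball (x := (0 : Plane)) (r := √(a (j + 1)))).subset fun x hx => ?_
      simpa [Real.lt_sqrt (norm_nonneg x)] using hx.2
    have hd : Pairwise fun i j => Disjoint (B i) (B j) := by
      have aux : ∀ i j : Fin n, i < j → Disjoint (B i) (B j) := by
        intro i j hij
        rw [Set.disjoint_left]
        intro x hx hx'
        have h1 : ((i : ℕ) : ℝ) + 1 ≤ ((j : ℕ) : ℝ) := by exact_mod_cast hij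
        have h2 : a (i + 1) ≤ a j := by simp only [ha]; push_cast; gcongr
        linarith [hx.2, hx'.1]
      intro i j hij
      rcases lt_or_gt_of_ne hij with h | h
      · exact aux i j h
      · exact (aux j i h).symm
    have hvol : ∀ j, volume.real (B j) = Real.pi * h := fun j => by
      rw [hBdef, volume_real_annulus (ha0 _) (by linarith [hstep j]), hstep]
    -- Inner-edge thresholds are the stricter ones and give the lower bound; the outer-edge
    -- thresholds of `hU` give the upper bound.
    have hL := N.real_forall_eve_le hB hb hd (t := fun j => s * a j ^ (p.α / 2))
      fun j => by have := ha0 j; positivity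
    have hU := N.real_forall_eve_le hB hb hd (t := fun j => s * a (j + 1) ^ (p.α / 2))
      fun j => by have := ha0 (j + 1); positivity
    simp only [hvol] at hL hU
    rw [← Finset.mul_sum, Fin.sum_univ_eq_sum_range (fun j => f (a j)) n] at hL
    rw [← Finset.mul_sum, Fin.sum_univ_eq_sum_range (fun j => f (a (j + 1))) n] at hU
    -- The upper and lower Riemann sums differ by `h * (f (a 0) - f (a n))`, and `f` takes values in
    -- `(0, 1]` at these points.
    have htel : h * ∑ i ∈ Finset.range n, f (a i) - h * ∑ i ∈ Finset.range n, f (a (i + 1)) ≤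
        h := by
      rw [← mul_sub, ← Finset.sum_sub_distrib, Finset.sum_range_sub' (fun i => f (a i))]
      have h1 : f (a 0) ≤ 1 := by
        simp only [hf, Real.exp_le_one_iff, neg_nonpos]
        have := ha0 0
        positivity
      have h2 : 0 < f (a n) := Real.exp_pos _
      nlinarith
    have hc : 0 < p.lam * Real.pi := by positivity
    constructor
    · calc _ ≤ _ := ?_
        _ = _ := hL.symm
        _ ≤ _ := measureReal_mono ?_
      · rw [Real.exp_le_exp, neg_le_neg_iff]
        have := mul_le_mul_of_nonneg_left
          (show h * ∑ i ∈ Finset.range n, f (a i) ≤ J + h by linarith) hc.le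
        linarith
      · intro ω hω e he1 he2
        set v := ‖N.X e ω‖ ^ 2 with hv
        -- The floor of this quotient is the index of the ring that contains the point.
        have hx0 : 0 ≤ (v - p.rp ^ 2) / h := div_nonneg (by linarith) hh0.le
        have hi1 : (⌊(v - p.rp ^ 2) / h⌋₊ : ℝ) ≤ (v - p.rp ^ 2) / h := Nat.floor_le hx0
        have hi2 := Nat.lt_floor_add_one ((v - p.rp ^ 2) / h)
        have hin : ⌊(v - p.rp ^ 2) / h⌋₊ < n := by
          rw [Nat.floor_lt hx0, div_lt_iff₀ hh0, hh]
          field_simp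
          linarith
        rw [le_div_iff₀ hh0] at hi1
        rw [div_lt_iff₀ hh0] at hi2
        have h1 : a ⌊(v - p.rp ^ 2) / h⌋₊ ≤ v := by simp only [ha]; linarith
        refine (hω ⟨_, hin⟩ e ⟨h1, ?_⟩).trans ?_
        · simp only [ha]
          push_cast
          linarith
        · rw [rpow_norm_eq, ← hv]
          exact mul_le_mul_of_nonneg_left
            (Real.rpow_le_rpow (ha0 _) h1 (by positivity)) hs.le
    · calc _ ≤ _ := measureReal_mono ?_
        _ = _ := hU
        _ ≤ _ := ?_
      · intro ω hω j e hj
        have h1 : ((j : ℕ) : ℝ) + 1 ≤ n := by exact_mod_cast j.2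
        have h2 : a (j + 1) ≤ p.rp ^ 2 + T := by
          have : h * ((j : ℕ) + 1) ≤ h * n := by gcongr
          rw [hh, div_mul_cancel₀ _ hn'.ne', ← hh] at this
          simp only [ha]
          push_cast
          linarith
        have h3 : p.rp ^ 2 ≤ a j := by
          simp only [ha]
          linarith [show 0 ≤ h * ((j : ℕ) : ℝ) by positivity]
        refine (hω e (h3.trans hj.1) (hj.2.trans_le h2)).trans ?_
        rw [rpow_norm_eq]
        exact mul_le_mul_of_nonneg_left
          (Real.rpow_le_rpow (by positivity) hj.2.le (by positivity)) hs.le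
      · rw [Real.exp_le_exp, neg_le_neg_iff]
        have := mul_le_mul_of_nonneg_left
          (show J - h ≤ h * ∑ i ∈ Finset.range n, f (a (i + 1)) by linarith) hc.le
        linarith
  have hT0 : Filter.Tendsto (fun n : ℕ => T / n) Filter.atTop (nhds 0) :=
    tendsto_const_div_atTop_nhds_zero_nat T
  have hcont : ∀ σ : ℝ, Filter.Tendsto
      (fun n : ℕ => Real.exp (-(p.lam * Real.pi * (J + σ * (T / n))))) Filter.atTop
      (nhds (Real.exp (-(p.lam * Real.pi * J)))) := by
    intro σ
    have h1 : Continuous fun x : ℝ => Real.exp (-(p.lam * Real.pi * (J + σ * x))) := by fun_prop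
    have h2 := (h1.tendsto 0).comp hT0
    simp only [mul_zero, add_zero] at h2
    exact h2
  refine le_antisymm (ge_of_tendsto (hcont (-1)) ?_) (le_of_tendsto (hcont 1) ?_)
  · filter_upwards [Filter.eventually_gt_atTop 0] with n hn
    simpa [sub_eq_add_neg] using (key n hn).2
  · filter_upwards [Filter.eventually_gt_atTop 0] with n hn
    simpa using (key n hn).1

end NOMANetwork

/-! ### The upper incomplete Gamma function -/

theorem integrableOn_upperGamma_integrand {δ x : ℝ} (hδ : 0 < δ) (hx : 0 ≤ x) :
    IntegrableOn (fun t => t ^ (δ - 1) * Real.exp (-t)) (Set.Ioi x) := by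
  have := (Real.GammaIntegral_convergent hδ).mono_set (Set.Ioi_subset_Ioi hx)
  simpa only [mul_comm] using this

section

variable {α s c : ℝ}

/-- The substitution `v = t ^ (2 / α)` makes the exponent linear. The indicators carry the lower
limit, because the change of variables is applied on the whole half-line. -/
theorem exp_neg_mul_rpow_comp_eqOn (hα : 0 < α) (hc : 0 < c) :
    Set.EqOn (fun t : ℝ => (|2 / α| * t ^ (2 / α - 1)) •
        (Set.Ioi c).indicator (fun v => Real.exp (-(s * v ^ (α / 2)))) (t ^ (2 / α)))
      ((Set.Ioi (c ^ (α / 2))).indicator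
        fun t => 2 / α * (t ^ (2 / α - 1) * Real.exp (-(s * t)))) (Set.Ioi 0) := by
  intro t ht
  have ht : 0 < t := ht
  have h1 : (t ^ (2 / α)) ^ (α / 2) = t := by
    rw [← Real.rpow_mul ht.le, show 2 / α * (α / 2) = 1 by field_simp, Real.rpow_one]
  have h2 : c < t ^ (2 / α) ↔ c ^ (α / 2) < t := by
    rw [← Real.rpow_lt_rpow_iff hc.le (by positivity) (show 0 < α / 2 by positivity), h1]
  simp only [Set.indicator, Set.mem_Ioi, h2, h1, smul_eq_mul, abs_of_pos (show 0 < 2 / α by positivity)]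
  split_ifs <;> ring

theorem integral_rpow_mul_exp_neg_mul (hs : 0 < s) (hc : 0 < c) (δ : ℝ) :
    ∫ t in Set.Ioi c, t ^ (δ - 1) * Real.exp (-(s * t)) = s ^ (-δ) * upperGamma δ (s * c) := by
  have h := integral_comp_mul_left_Ioi (fun t => t ^ (δ - 1) * Real.exp (-t)) c hs
  rw [upperGamma, ← mul_inv_cancel_left₀ hs.ne' (∫ t in Set.Ioi (s * c), _), ← smul_eq_mul s⁻¹,
    ← h, ← mul_assoc, ← integral_const_mul]
  refine setIntegral_congr_fun measurableSet_Ioi fun t ht => ?_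
  have ht : 0 < t := hc.trans ht
  rw [Real.mul_rpow hs.le ht.le, Real.rpow_neg hs.le, Real.rpow_sub_one hs.ne']
  have := Real.rpow_pos_of_pos hs δ
  field_simp

theorem integrableOn_rpow_mul_exp_neg_mul (hs : 0 < s) (hc : 0 < c) {δ : ℝ} (hδ : 0 < δ) :
    IntegrableOn (fun t => t ^ (δ - 1) * Real.exp (-(s * t))) (Set.Ioi c) := by
  have h := (integrableOn_Ioi_comp_mul_left_iff (fun t => t ^ (δ - 1) * Real.exp (-t)) c hs).2
    (integrableOn_upperGamma_integrand hδ (by positivity))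
  refine IntegrableOn.congr_fun (h.const_mul (s ^ (δ - 1))⁻¹) (fun t ht => ?_) measurableSet_Ioi
  have ht : 0 < t := hc.trans ht
  have := Real.rpow_pos_of_pos hs (δ - 1)
  rw [Real.mul_rpow hs.le ht.le]
  field_simp

theorem integral_exp_neg_mul_rpow_Ioi (hα : 0 < α) (hs : 0 < s) (hc : 0 < c) :
    ∫ v in Set.Ioi c, Real.exp (-(s * v ^ (α / 2))) =
      2 / α * (s ^ (-(2 / α)) * upperGamma (2 / α) (s * c ^ (α / 2))) := by
  have hp : 2 / α ≠ 0 := by positivity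
  have hc' : 0 < c ^ (α / 2) := by positivity
  have h := integral_comp_rpow_Ioi
    ((Set.Ioi c).indicator fun v => Real.exp (-(s * v ^ (α / 2)))) hp
  rw [setIntegral_congr_fun measurableSet_Ioi (exp_neg_mul_rpow_comp_eqOn hα hc),
    setIntegral_indicator measurableSet_Ioi, setIntegral_indicator measurableSet_Ioi,
    Set.Ioi_inter_Ioi, Set.Ioi_inter_Ioi, max_eq_right hc.le, max_eq_right hc'.le,
    integral_const_mul, integral_rpow_mul_exp_neg_mul hs hc'] at h
  exact h.symm

theorem integrableOn_exp_neg_mul_rpow_Ioi (hα : 0 < α) (hs : 0 < s) (hc : 0 < c) :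
    IntegrableOn (fun v => Real.exp (-(s * v ^ (α / 2)))) (Set.Ioi c) := by
  have hp : 2 / α ≠ 0 := by positivity
  have hc' : 0 < c ^ (α / 2) := by positivity
  have h := integrableOn_Ioi_comp_rpow_iff
    ((Set.Ioi c).indicator fun v => Real.exp (-(s * v ^ (α / 2)))) hp
  rw [integrableOn_congr_fun (exp_neg_mul_rpow_comp_eqOn hα hc) measurableSet_Ioi,
    integrableOn_indicator_iff measurableSet_Ioi, integrableOn_indicator_iff measurableSet_Ioi,
    Set.Ioi_inter_Ioi, Set.Ioi_inter_Ioi, max_eq_left hc.le, max_eq_left hc'.le] at h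
  exact h.1 ((integrableOn_rpow_mul_exp_neg_mul hs hc' (by positivity)).const_mul _)

end

theorem upperGamma_pos {δ x : ℝ} (hδ : 0 < δ) (hx : 0 ≤ x) : 0 < upperGamma δ x := by
  rw [upperGamma, setIntegral_pos_iff_support_of_nonneg_ae _ (integrableOn_upperGamma_integrand hδ hx)]
  · refine lt_of_lt_of_le ?_ (measure_mono (s := Set.Ioi x) fun t ht => ?_)
    · simp
    · have : 0 < t := lt_of_le_of_lt hx ht
      exact ⟨by simp only [Function.mem_support]; positivity, ht⟩
  · filter_upwards [ae_restrict_mem measurableSet_Ioi] with t ht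
    have : 0 < t := lt_of_le_of_lt hx ht
    simp only [Pi.zero_apply]
    positivity

theorem upperGamma_anti {δ x y : ℝ} (hδ : 0 < δ) (hx : 0 ≤ x) (hxy : x ≤ y) :
    upperGamma δ y ≤ upperGamma δ x := by
  refine setIntegral_mono_set (integrableOn_upperGamma_integrand hδ hx) ?_
    (Set.Ioi_subset_Ioi hxy).eventuallyLE
  filter_upwards [ae_restrict_mem measurableSet_Ioi] with t ht
  have : 0 < t := lt_of_le_of_lt hx ht
  simp only [Pi.zero_apply]
  positivity

/-- For nonnegative arguments it is `upperGamma δ 0` minus a primitive of the integrand, which is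
continuous at `x > 0`. -/
theorem hasDerivAt_upperGamma {δ x : ℝ} (hδ : 0 < δ) (hx : 0 < x) :
    HasDerivAt (upperGamma δ) (-(x ^ (δ - 1) * Real.exp (-x))) x := by
  have hi := integrableOn_upperGamma_integrand hδ le_rfl
  have hI : ∀ y, 0 ≤ y → IntervalIntegrable (fun t => t ^ (δ - 1) * Real.exp (-t)) volume 0 y :=
    fun y hy => (intervalIntegrable_iff_integrableOn_Ioc_of_le hy).2
      (hi.mono_set Set.Ioc_subset_Ioi_self)
  have h0 : ∀ y, 0 ≤ y → upperGamma δ y =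
      upperGamma δ 0 - ∫ t in (0 : ℝ)..y, t ^ (δ - 1) * Real.exp (-t) := by
    intro y hy
    rw [upperGamma, upperGamma, eq_sub_iff_add_eq, add_comm]
    exact intervalIntegral.integral_interval_add_Ioi hi
      (integrableOn_upperGamma_integrand hδ hy)
  have hc : ContinuousAt (fun t : ℝ => t ^ (δ - 1) * Real.exp (-t)) x :=
    (Real.continuousAt_rpow_const _ _ (Or.inl hx.ne')).mul (by fun_prop)
  have hd := intervalIntegral.integral_hasDerivAt_right (hI x hx.le)
    (Measurable.stronglyMeasurable (by fun_prop)).stronglyMeasurableAtFilter hc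
  refine (hd.const_sub (upperGamma δ 0)).congr_of_eventuallyEq ?_
  filter_upwards [lt_mem_nhds hx] with y hy using h0 y hy.le

/-! ### The closed-form CDF of the eavesdropper SNR -/

namespace NOMAParams

variable (p : NOMAParams)

theorem am_pos : 0 < p.am := p.an_pos.trans p.an_lt_am

theorem δ_pos : 0 < p.δ := div_pos two_pos p.α_pos

theorem ρeam_pos : 0 < p.ρe * p.am := mul_pos p.ρe_pos p.am_pos

theorem rp_pos : 0 < p.rp := one_pos.trans p.one_lt_rp

theorem μ1_pos : 0 < p.μ1 := by
  have := p.δ_pos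
  have := p.ρeam_pos
  have := p.lam_pos
  unfold μ1
  positivity

theorem μ2_pos : 0 < p.μ2 := by
  have := p.rp_pos
  have := p.ρeam_pos
  unfold μ2
  positivity

/-- After rescaling by `ρe * am` the transmit parameters cancel, leaving the form that the Poisson
computation produces. -/
theorem cdfE_mul {s : ℝ} (hs : 0 < s) : p.cdfE (p.ρe * p.am * s) =
    Real.exp (-(p.lam * Real.pi * (p.δ * (s ^ (-p.δ) * upperGamma p.δ (s * p.rp ^ p.α))))) := by
  have h := p.ρeam_pos
  rw [cdfE, μ1, μ2]
  congr 2
  rw [Real.mul_rpow h.le hs.le, Real.rpow_neg hs.le,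
    show p.rp ^ p.α / (p.ρe * p.am) * (p.ρe * p.am * s) = s * p.rp ^ p.α by
      rw [← mul_assoc, div_mul_cancel₀ _ h.ne', mul_comm]]
  have h1 := Real.rpow_pos_of_pos h p.δ
  have h2 := Real.rpow_pos_of_pos hs p.δ
  field_simp

theorem cdfE_pos (x : ℝ) : 0 < p.cdfE x := Real.exp_pos _

theorem preE_nonneg {x : ℝ} (hx : 0 < x) : 0 ≤ p.preE x := by
  have := p.μ1_pos
  have := p.μ2_pos
  have := p.δ_pos
  have := upperGamma_pos p.δ_pos (show 0 ≤ p.μ2 * x by positivity)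
  unfold preE
  positivity

theorem hasDerivAt_cdfE {x : ℝ} (hx : 0 < x) : HasDerivAt p.cdfE (p.preE x * p.cdfE x) x := by
  have h1 := p.μ1_pos
  have h2 := p.μ2_pos
  have hδ := p.δ_pos
  have hx2 : 0 < p.μ2 * x := by positivity
  have hG : HasDerivAt (fun x => upperGamma p.δ (p.μ2 * x))
      (-((p.μ2 * x) ^ (p.δ - 1) * Real.exp (-(p.μ2 * x))) * p.μ2) x :=
    (hasDerivAt_upperGamma hδ hx2).comp x
      (((hasDerivAt_id x).const_mul p.μ2).congr_deriv (mul_one _))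
  have hX : HasDerivAt (fun x : ℝ => x ^ p.δ) (p.δ * x ^ (p.δ - 1)) x :=
    Real.hasDerivAt_rpow_const (Or.inl hx.ne')
  have hxp := Real.rpow_pos_of_pos hx p.δ
  refine (((hG.const_mul p.μ1).div hX hxp.ne').neg.exp).congr_deriv ?_
  rw [mul_comm]
  congr 1
  rw [preE, Real.mul_rpow h2.le hx.le, Real.rpow_sub_one hx.ne', Real.rpow_sub_one h2.ne',
    Real.rpow_add_one hx.ne']
  field_simp
  ring

theorem tendsto_cdfE_atTop : Filter.Tendsto p.cdfE Filter.atTop (nhds 1) := by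
  have h1 := p.μ1_pos
  have h2 := p.μ2_pos
  have hδ := p.δ_pos
  have h3 : Filter.Tendsto (fun x : ℝ => Real.exp (-(p.μ1 * upperGamma p.δ 0 / x ^ p.δ)))
      Filter.atTop (nhds 1) := by
    have h := (tendsto_rpow_atTop hδ).const_div_atTop (p.μ1 * upperGamma p.δ 0)
    have h' := (Real.continuous_exp.tendsto _).comp h.neg
    simp only [neg_zero, Real.exp_zero] at h'
    exact h'
  refine tendsto_of_tendsto_of_tendsto_of_le_of_le' h3 tendsto_const_nhds ?_ ?_
  · filter_upwards [Filter.eventually_gt_atTop 0] with x hx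
    rw [cdfE, Real.exp_le_exp, neg_le_neg_iff]
    have := upperGamma_anti hδ le_rfl (show 0 ≤ p.μ2 * x by positivity)
    gcongr
  · filter_upwards [Filter.eventually_gt_atTop 0] with x hx
    have := upperGamma_pos hδ (show 0 ≤ p.μ2 * x by positivity)
    rw [cdfE, Real.exp_le_one_iff, neg_nonpos]
    positivity

/-- For `μ2 * x ≤ 1` the Gamma factor stays above `upperGamma δ 1 > 0`, while `x ^ (-δ)` blows up.
-/
theorem tendsto_cdfE_zero : Filter.Tendsto p.cdfE (nhdsWithin 0 (Set.Ioi 0)) (nhds 0) := by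
  have h1 := p.μ1_pos
  have h2 := p.μ2_pos
  have hδ := p.δ_pos
  have hG := upperGamma_pos hδ zero_le_one
  have h3 : Filter.Tendsto
      (fun x : ℝ => Real.exp (-(p.μ1 * upperGamma p.δ 1 * x ^ (-p.δ))))
      (nhdsWithin 0 (Set.Ioi 0)) (nhds 0) :=
    Real.tendsto_exp_neg_atTop_nhds_zero.comp
      ((tendsto_rpow_neg_nhdsGT_zero (by linarith)).const_mul_atTop (by positivity))
  refine tendsto_of_tendsto_of_tendsto_of_le_of_le' tendsto_const_nhds h3 ?_ ?_
  · filter_upwards with x using (p.cdfE_pos x).le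
  · filter_upwards [Ioo_mem_nhdsGT (show 0 < 1 / p.μ2 by positivity)] with x hx
    have hx0 : 0 < x := hx.1
    have hx1 : p.μ2 * x ≤ 1 := by
      have := hx.2.le
      rw [le_div_iff₀ h2] at this
      linarith
    rw [cdfE, Real.exp_le_exp, neg_le_neg_iff, Real.rpow_neg hx0.le, ← div_eq_mul_inv]
    have := upperGamma_anti hδ (show 0 ≤ p.μ2 * x by positivity) hx1
    gcongr

end NOMAParams

/-! ### Measurability, density and law of the eavesdropper SNR -/

/-- Largest channel power gain of the active eavesdroppers, as a function of the positions and
fading coefficients. -/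
noncomputable def eveSup (p : NOMAParams) (z : (ℕ → Plane) × (ℕ → ℂ)) : ℝ :=
  sSup {y | ∃ e, p.rp ≤ ‖z.1 e‖ ∧ y = ‖z.2 e‖ ^ 2 * (1 / ‖z.1 e‖ ^ p.α)}

theorem measurableSet_eve_le (p : NOMAParams) (x : ℝ) :
    MeasurableSet {z : (ℕ → Plane) × (ℕ → ℂ) |
      ∀ e, p.rp ≤ ‖z.1 e‖ → ‖z.2 e‖ ^ 2 * (1 / ‖z.1 e‖ ^ p.α) ≤ x} := by
  have : {z : (ℕ → Plane) × (ℕ → ℂ) |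
      ∀ e, p.rp ≤ ‖z.1 e‖ → ‖z.2 e‖ ^ 2 * (1 / ‖z.1 e‖ ^ p.α) ≤ x} =
      ⋂ e, ({z | p.rp ≤ ‖z.1 e‖}ᶜ ∪ {z | ‖z.2 e‖ ^ 2 * (1 / ‖z.1 e‖ ^ p.α) ≤ x}) := by
    ext z
    simp only [Set.mem_ofPred_eq, Set.mem_iInter, Set.mem_union, Set.mem_compl_iff,
      imp_iff_not_or]
  rw [this]
  exact MeasurableSet.iInter fun e =>
    (measurableSet_le measurable_const (by fun_prop)).compl.union
      (measurableSet_le (by fun_prop) measurable_const)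

theorem measurable_eveSup (p : NOMAParams) : Measurable (eveSup p) := by
  have hbdd : MeasurableSet {z : (ℕ → Plane) × (ℕ → ℂ) |
      BddAbove {y | ∃ e, p.rp ≤ ‖z.1 e‖ ∧ y = ‖z.2 e‖ ^ 2 * (1 / ‖z.1 e‖ ^ p.α)}} := by
    have : {z : (ℕ → Plane) × (ℕ → ℂ) |
        BddAbove {y | ∃ e, p.rp ≤ ‖z.1 e‖ ∧ y = ‖z.2 e‖ ^ 2 * (1 / ‖z.1 e‖ ^ p.α)}} =
        ⋃ k : ℕ, {z | ∀ e, p.rp ≤ ‖z.1 e‖ → ‖z.2 e‖ ^ 2 * (1 / ‖z.1 e‖ ^ p.α) ≤ k} := by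
      ext z
      simp only [Set.mem_ofPred_eq, Set.mem_iUnion]
      constructor
      · rintro ⟨b, hb⟩
        obtain ⟨k, hk⟩ := exists_nat_ge b
        exact ⟨k, fun e he => (hb ⟨e, he, rfl⟩).trans hk⟩
      · rintro ⟨k, hk⟩
        refine ⟨k, ?_⟩
        rintro y ⟨e, he, rfl⟩
        exact hk e he
    rw [this]
    exact MeasurableSet.iUnion fun k => measurableSet_eve_le p k
  have hnn : ∀ z, 0 ≤ eveSup p z := fun z => Real.sSup_nonneg (by
    rintro y ⟨e, _, rfl⟩
    positivity)
  refine measurable_of_Iic fun x => ?_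
  rcases lt_or_ge x 0 with hx | hx
  · convert! MeasurableSet.empty
    ext z
    simpa using hx.trans_le (hnn z)
  · convert! (measurableSet_eve_le p x).union hbdd.compl
    ext z
    simp only [Set.mem_preimage, Set.mem_Iic, Set.mem_union, Set.mem_ofPred_eq,
      Set.mem_compl_iff]
    constructor
    · intro h
      by_cases hb : BddAbove {y | ∃ e, p.rp ≤ ‖z.1 e‖ ∧ y = ‖z.2 e‖ ^ 2 * (1 / ‖z.1 e‖ ^ p.α)}
      · exact Or.inl fun e he => (le_csSup hb ⟨e, he, rfl⟩).trans h
      · exact Or.inr hb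
    · rintro (h | h)
      · refine Real.sSup_le ?_ hx
        rintro y ⟨e, he, rfl⟩
        exact h e he
      -- An unbounded set has real supremum 0 by convention, so it belongs to the sublevel set of
      -- every `x ≥ 0`.
      · rw [eveSup, Real.sSup_of_not_bddAbove h]
        exact hx

namespace NOMAParams

variable (p : NOMAParams)

/-- Density of the eavesdropper SNR on the positive half-line. -/
noncomputable def pdfE (x : ℝ) : ℝ := p.preE x * p.cdfE x

theorem pdfE_nonneg {x : ℝ} (hx : 0 < x) : 0 ≤ p.pdfE x :=
  mul_nonneg (p.preE_nonneg hx) (p.cdfE_pos x).le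

/-- The CDF of the eavesdropper SNR on the whole line. -/
noncomputable def cdfEExt (x : ℝ) : ℝ := if x ≤ 0 then 0 else p.cdfE x

theorem cdfEExt_of_pos {x : ℝ} (hx : 0 < x) : p.cdfEExt x = p.cdfE x := if_neg hx.not_ge

theorem hasDerivAt_cdfEExt {x : ℝ} (hx : 0 < x) : HasDerivAt p.cdfEExt (p.pdfE x) x := by
  refine (p.hasDerivAt_cdfE hx).congr_of_eventuallyEq ?_
  filter_upwards [lt_mem_nhds hx] with y hy using p.cdfEExt_of_pos hy

theorem continuousWithinAt_cdfEExt_zero : ContinuousWithinAt p.cdfEExt (Set.Ici 0) 0 := by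
  rw [← continuousWithinAt_Ioi_iff_Ici, ContinuousWithinAt, show p.cdfEExt 0 = 0 by simp [cdfEExt]]
  refine p.tendsto_cdfE_zero.congr' ?_
  filter_upwards [self_mem_nhdsWithin] with y hy using (p.cdfEExt_of_pos hy).symm

theorem tendsto_cdfEExt_atTop : Filter.Tendsto p.cdfEExt Filter.atTop (nhds 1) := by
  refine p.tendsto_cdfE_atTop.congr' ?_
  filter_upwards [Filter.eventually_gt_atTop 0] with y hy using (p.cdfEExt_of_pos hy).symm

/-- A nonnegative derivative of a function with finite limits at both ends is integrable. The
convergence of the later integrals rests on this, since there the density is multiplied by bounded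
factors. -/
theorem integrableOn_pdfE : IntegrableOn p.pdfE (Set.Ioi 0) :=
  integrableOn_Ioi_deriv_of_nonneg p.continuousWithinAt_cdfEExt_zero
    (fun _ hx => p.hasDerivAt_cdfEExt hx) (fun _ hx => p.pdfE_nonneg hx) p.tendsto_cdfEExt_atTop

theorem intervalIntegrable_pdfE {x : ℝ} (hx : 0 ≤ x) : IntervalIntegrable p.pdfE volume 0 x :=
  (intervalIntegrable_iff_integrableOn_Ioc_of_le hx).2
    (p.integrableOn_pdfE.mono_set Set.Ioc_subset_Ioi_self)

theorem integral_pdfE {x : ℝ} (hx : 0 < x) : ∫ t in (0 : ℝ)..x, p.pdfE t = p.cdfE x := by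
  rw [intervalIntegral.integral_eq_sub_of_hasDerivAt_of_le hx.le
    (f := p.cdfEExt) ?_ (fun t ht => p.hasDerivAt_cdfEExt ht.1) (p.intervalIntegrable_pdfE hx.le),
    p.cdfEExt_of_pos hx]
  · simp [cdfEExt]
  · intro t ht
    rcases ht.1.eq_or_lt with rfl | h
    · exact p.continuousWithinAt_cdfEExt_zero.mono Set.Icc_subset_Ici_self
    · exact (p.hasDerivAt_cdfEExt h).continuousAt.continuousWithinAt

theorem integral_Ioi_pdfE {x : ℝ} (hx : 0 < x) : ∫ t in Set.Ioi x, p.pdfE t = 1 - p.cdfE x := by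
  refine integral_Ioi_of_hasDerivAt_of_tendsto'
    (fun t ht => p.hasDerivAt_cdfE (hx.trans_le ht))
    (p.integrableOn_pdfE.mono_set (Set.Ioi_subset_Ioi hx.le)) p.tendsto_cdfE_atTop

end NOMAParams

namespace NOMANetwork

variable {p : NOMAParams} {Ω : Type*} [MeasurableSpace Ω] {μ : Measure Ω} (N : NOMANetwork p μ)

theorem measurable_eves : Measurable fun ω => ((fun e => N.X e ω), fun e => N.g e ω) := by
  have := N.ppp_X.1
  have := N.measurable_g
  fun_prop

theorem measurable_snrE : Measurable N.snrE :=
  ((measurable_eveSup p).comp N.measurable_eves).const_mul _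

/-- The annuli exhaust the region outside the exclusion zone, and continuity from above passes to
the limit. The limiting integral is finite because `α > 0`. -/
theorem real_eve_le [IsProbabilityMeasure μ] {s : ℝ} (hs : 0 < s) :
    μ.real {ω | ∀ e, p.rp ≤ ‖N.X e ω‖ → ‖N.g e ω‖ ^ 2 * (1 / ‖N.X e ω‖ ^ p.α) ≤ s} =
      p.cdfE (p.ρe * p.am * s) := by
  have hrp := p.rp_pos
  have hX := N.ppp_X.1
  have hg := N.measurable_g
  set Q : ℕ → Set Ω := fun k => {ω | ∀ e, p.rp ^ 2 ≤ ‖N.X e ω‖ ^ 2 →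
    ‖N.X e ω‖ ^ 2 < p.rp ^ 2 + (k + 1 : ℕ) → ‖N.g e ω‖ ^ 2 ≤ s * ‖N.X e ω‖ ^ p.α} with hQ
  have hQm : ∀ k, MeasurableSet (Q k) := by
    intro k
    have : Q k = ⋂ e, ({ω | p.rp ^ 2 ≤ ‖N.X e ω‖ ^ 2}ᶜ ∪
        ({ω | ‖N.X e ω‖ ^ 2 < p.rp ^ 2 + (k + 1 : ℕ)}ᶜ ∪
          {ω | ‖N.g e ω‖ ^ 2 ≤ s * ‖N.X e ω‖ ^ p.α})) := by
      ext ω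
      simp only [hQ, Set.mem_ofPred_eq, Set.mem_iInter, Set.mem_union, Set.mem_compl_iff,
        imp_iff_not_or]
    rw [this]
    refine MeasurableSet.iInter fun e => (measurableSet_le measurable_const ?_).compl.union
      ((measurableSet_lt ?_ measurable_const).compl.union (measurableSet_le ?_ ?_))
    all_goals
      have := hX e
      have := hg e
      fun_prop
  have hanti : Antitone Q := by
    intro i j hij ω hω e h1 h2
    refine hω e h1 (h2.trans_le ?_)
    gcongr
  have hI : {ω | ∀ e, p.rp ≤ ‖N.X e ω‖ → ‖N.g e ω‖ ^ 2 * (1 / ‖N.X e ω‖ ^ p.α) ≤ s} =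
      ⋂ k, Q k := by
    ext ω
    simp only [Set.mem_ofPred_eq, Set.mem_iInter, hQ]
    have hsq : ∀ e, p.rp ≤ ‖N.X e ω‖ ↔ p.rp ^ 2 ≤ ‖N.X e ω‖ ^ 2 := fun e =>
      (pow_le_pow_iff_left₀ hrp.le (norm_nonneg _) two_ne_zero).symm
    have hdiv : ∀ e, p.rp ≤ ‖N.X e ω‖ → (‖N.g e ω‖ ^ 2 * (1 / ‖N.X e ω‖ ^ p.α) ≤ s ↔
        ‖N.g e ω‖ ^ 2 ≤ s * ‖N.X e ω‖ ^ p.α) := fun e he => by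
      have := Real.rpow_pos_of_pos (hrp.trans_le he) p.α
      rw [mul_one_div, div_le_iff₀ this]
    constructor
    · intro h k e he _
      exact (hdiv e ((hsq e).2 he)).1 (h e ((hsq e).2 he))
    · intro h e he
      obtain ⟨k, hk⟩ := exists_nat_gt (‖N.X e ω‖ ^ 2)
      refine (hdiv e he).2 (h k e ((hsq e).1 he) (hk.trans ?_))
      push_cast
      nlinarith [sq_nonneg p.rp]
  have h1 := tendsto_measure_iInter_atTop (μ := μ) (fun k => (hQm k).nullMeasurableSet) hanti
    ⟨0, measure_ne_top _ _⟩
  rw [← hI] at h1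
  have h2 : Filter.Tendsto (fun k => μ.real (Q k)) Filter.atTop (nhds (μ.real
      {ω | ∀ e, p.rp ≤ ‖N.X e ω‖ → ‖N.g e ω‖ ^ 2 * (1 / ‖N.X e ω‖ ^ p.α) ≤ s})) :=
    (ENNReal.tendsto_toReal (measure_ne_top _ _)).comp h1
  refine tendsto_nhds_unique h2 ?_
  have h3 : ∀ k, μ.real (Q k) = _ := fun k =>
    N.real_eve_le_annulus hs (T := (k + 1 : ℕ)) (by positivity)
  simp only [h3]
  rw [p.cdfE_mul hs]
  have h4 := integral_exp_neg_mul_rpow_Ioi p.α_pos hs (show 0 < p.rp ^ 2 by positivity)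
  have h5 : (p.rp ^ 2) ^ (p.α / 2) = p.rp ^ p.α := by
    rw [← Real.rpow_natCast, ← Real.rpow_mul hrp.le]
    congr 1
    push_cast
    ring
  rw [h5] at h4
  rw [NOMAParams.δ, ← h4]
  have hlim : Filter.Tendsto (fun k : ℕ => p.rp ^ 2 + ((k + 1 : ℕ) : ℝ)) Filter.atTop
      Filter.atTop :=
    Filter.tendsto_atTop_add_const_left _ _
      (tendsto_natCast_atTop_atTop.comp (Filter.tendsto_add_atTop_nat 1))
  have h6 := intervalIntegral_tendsto_integral_Ioi (p.rp ^ 2)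
    (integrableOn_exp_neg_mul_rpow_Ioi p.α_pos hs (show 0 < p.rp ^ 2 by positivity)) hlim
  have hc : Continuous fun x : ℝ => Real.exp (-(p.lam * Real.pi * x)) := by fun_prop
  exact (hc.tendsto _).comp h6

/-- The probability that all gains are at most `k + 1` is a value of `cdfE` that tends to one, so
the union of these events has full measure. -/
theorem bddAbove_eveGains [IsProbabilityMeasure μ] : ∀ᵐ ω ∂μ, BddAbove (N.eveGains ω) := by
  have hm : ∀ x : ℝ, MeasurableSet
      {ω | ∀ e, p.rp ≤ ‖N.X e ω‖ → ‖N.g e ω‖ ^ 2 * (1 / ‖N.X e ω‖ ^ p.α) ≤ x} :=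
    fun x => N.measurable_eves (measurableSet_eve_le p x)
  set E := ⋃ k : ℕ, {ω | ∀ e, p.rp ≤ ‖N.X e ω‖ →
    ‖N.g e ω‖ ^ 2 * (1 / ‖N.X e ω‖ ^ p.α) ≤ ((k + 1 : ℕ) : ℝ)} with hE
  have hEm : MeasurableSet E := MeasurableSet.iUnion fun k => hm _
  have h1 : (1 : ℝ) ≤ μ.real E := by
    have hlim : Filter.Tendsto (fun k : ℕ => p.ρe * p.am * ((k + 1 : ℕ) : ℝ)) Filter.atTop
        Filter.atTop :=
      (tendsto_natCast_atTop_atTop.comp (Filter.tendsto_add_atTop_nat 1)).const_mul_atTop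
        p.ρeam_pos
    refine le_of_tendsto (p.tendsto_cdfE_atTop.comp hlim) (Filter.Eventually.of_forall fun k => ?_)
    simp only [Function.comp]
    rw [← N.real_eve_le (show (0 : ℝ) < (k + 1 : ℕ) by positivity)]
    exact measureReal_mono (Set.subset_iUnion_of_subset k subset_rfl)
  have h2 : μ E = 1 := by
    refine le_antisymm prob_le_one ?_
    rw [← ofReal_measureReal]
    simpa using ENNReal.ofReal_le_ofReal h1
  filter_upwards [(mem_ae_iff_prob_eq_one hEm).2 h2] with ω hω
  obtain ⟨k, hk⟩ := Set.mem_iUnion.1 hω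
  refine ⟨((k + 1 : ℕ) : ℝ), ?_⟩
  rintro y ⟨e, he, rfl⟩
  exact hk e he

theorem real_snrE_le [IsProbabilityMeasure μ] {x : ℝ} (hx : 0 < x) :
    μ.real {ω | N.snrE ω ≤ x} = p.cdfE x := by
  have hc := p.ρeam_pos
  have h := N.real_eve_le (show 0 < x / (p.ρe * p.am) by positivity)
  rw [mul_div_cancel₀ _ hc.ne'] at h
  rw [← h]
  refine measureReal_congr ?_
  filter_upwards [N.bddAbove_eveGains] with ω hω
  apply propext
  change N.snrE ω ≤ x ↔
    ∀ e, p.rp ≤ ‖N.X e ω‖ → ‖N.g e ω‖ ^ 2 * (1 / ‖N.X e ω‖ ^ p.α) ≤ x / (p.ρe * p.am)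
  rw [snrE, mul_comm, ← le_div_iff₀ hc]
  constructor
  · exact fun h e he => (le_csSup hω ⟨e, he, rfl⟩).trans h
  · refine fun h => Real.sSup_le ?_ (by positivity)
    rintro y ⟨e, he, rfl⟩
    exact h e he

theorem map_snrE [IsProbabilityMeasure μ] : μ.map N.snrE =
    (volume.restrict (Set.Ioi 0)).withDensity fun x => ENNReal.ofReal (p.pdfE x) := by
  have hprob : IsProbabilityMeasure (μ.map N.snrE) :=
    Measure.isProbabilityMeasure_map N.measurable_snrE.aemeasurable
  have : IsFiniteMeasure
      ((volume.restrict (Set.Ioi 0)).withDensity fun x => ENNReal.ofReal (p.pdfE x)) :=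
    isFiniteMeasure_withDensity_ofReal p.integrableOn_pdfE.2
  refine Measure.ext_of_Iic _ _ fun x => ?_
  rw [Measure.map_apply N.measurable_snrE measurableSet_Iic, withDensity_apply _ measurableSet_Iic,
    Measure.restrict_restrict measurableSet_Iic, Set.inter_comm, Set.Ioi_inter_Iic]
  rcases le_or_gt x 0 with hx | hx
  · rw [Set.Ioc_eq_empty hx.not_gt]
    simp only [Measure.restrict_empty, lintegral_zero_measure]
    -- The mass of `(-∞, x]` is at most `cdfE y` for every `y > 0`, and this tends to 0; hence there
    -- is no atom at zero.
    have h0 : μ.real (N.snrE ⁻¹' Set.Iic x) ≤ 0 := by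
      refine ge_of_tendsto p.tendsto_cdfE_zero ?_
      filter_upwards [self_mem_nhdsWithin] with y hy
      rw [← N.real_snrE_le hy]
      exact measureReal_mono fun ω hω => (le_trans hω hx).trans (le_of_lt hy)
    rw [← ofReal_measureReal, ENNReal.ofReal_eq_zero]
    exact h0
  · rw [← ofReal_integral_eq_lintegral_ofReal
      (p.integrableOn_pdfE.mono_set Set.Ioc_subset_Ioi_self),
      ← intervalIntegral.integral_of_le hx.le, p.integral_pdfE hx, ← N.real_snrE_le hx,
      ofReal_measureReal]
    · rfl
    · filter_upwards [ae_restrict_mem measurableSet_Ioc] with t ht using p.pdfE_nonneg ht.1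

end NOMANetwork

/-! ### The outage event and the exact integral formula -/

/-- The secrecy outage event in terms of the eavesdropper SNR `x` and the channel gain `h`. -/
theorem secrecy_outage_iff {am an ρb R h x : ℝ} (ham : 0 < am) (han : 0 < an) (hρ : 0 < ρb)
    (hR : 0 < R) (hh : 0 ≤ h) (hx : 0 ≤ x) :
    max (Real.logb 2 (1 + am * h / (an * h + 1 / ρb)) - Real.logb 2 (1 + x)) 0 < R ↔
      (am - an * (2 ^ R * (1 + x) - 1)) * ρb * h < 2 ^ R * (1 + x) - 1 := by
  have hd : 0 < an * h + 1 / ρb := by positivity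
  have hB : 0 < 1 + am * h / (an * h + 1 / ρb) := by positivity
  have hE : 0 < 1 + x := by linarith
  have h2 : (2 : ℝ) ^ R * (1 + x) = 2 ^ (R + Real.logb 2 (1 + x)) := by
    rw [Real.rpow_add two_pos, Real.rpow_logb two_pos (by norm_num) hE]
  -- As `R > 0`, the positive part imposes no extra condition. Exponentiating and clearing the
  -- positive denominators leaves a linear inequality in `h`.
  rw [max_lt_iff, and_iff_left hR, sub_lt_iff_lt_add,
    ← Real.rpow_lt_rpow_left_iff one_lt_two, Real.rpow_logb two_pos (by norm_num) hB, ← h2,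
    ← lt_sub_iff_add_lt', div_lt_iff₀ hd, ← mul_lt_mul_iff_left₀ hρ]
  have : (2 ^ R * (1 + x) - 1) * (an * h + 1 / ρb) * ρb =
      (2 ^ R * (1 + x) - 1) * an * h * ρb + (2 ^ R * (1 + x) - 1) := by
    field_simp
  rw [this]
  constructor <;> intro h <;> linarith

namespace NOMAParams

variable (p : NOMAParams)

/-- With `1 - am = an`, the value `τ` is where the coefficient of the gain in the outage inequality
changes sign. -/
theorem lt_τ_iff {R x : ℝ} : x < p.τ R ↔ 0 < p.am - p.an * (2 ^ R * (1 + x) - 1) := by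
  have h1 : 0 < (2 : ℝ) ^ R := by positivity
  have h2 : 1 - p.am = p.an := by linarith [p.am_add_an]
  have h3 := p.an_pos
  have h4 : p.am = 1 - p.an := by linarith
  rw [τ, h2, lt_sub_iff_add_lt, lt_div_iff₀ (by positivity), h4]
  constructor <;> intro h <;> linarith

theorem outage_threshold_pos {R x : ℝ} (hR : 0 < R) (hx : 0 ≤ x) :
    0 < 2 ^ R * (1 + x) - 1 := by
  have h1 : (1 : ℝ) < 2 ^ R := Real.one_lt_rpow one_lt_two hR
  nlinarith

theorem thr_nonneg {R x : ℝ} (hR : 0 < R) (hx : 0 ≤ x) (hxτ : x < p.τ R) : 0 ≤ p.thr R x := by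
  have h1 := outage_threshold_pos hR hx
  have h2 := p.lt_τ_iff.1 hxτ
  have := p.ρb_pos
  unfold thr
  positivity

end NOMAParams

namespace NOMANetwork

variable {p : NOMAParams} {Ω : Type*} [MeasurableSpace Ω] {μ : Measure Ω} (N : NOMANetwork p μ)

theorem indep_snrE_gainm : IndepFun N.snrE N.gainm μ := by
  have hv : Measurable fun z : (Fin p.M → Plane) × (Fin p.M → ℂ) =>
      orderStat (fun i => ‖z.2 i‖ ^ 2 / (1 + ‖z.1 i‖ ^ p.α)) p.rankm := by
    refine measurable_of_Iio fun y => ?_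
    have : (fun z : (Fin p.M → Plane) × (Fin p.M → ℂ) =>
        orderStat (fun i => ‖z.2 i‖ ^ 2 / (1 + ‖z.1 i‖ ^ p.α)) p.rankm) ⁻¹' Set.Iio y =
        {z | (p.rankm : ℕ) < ∑ i, if ‖z.2 i‖ ^ 2 / (1 + ‖z.1 i‖ ^ p.α) < y then 1 else 0} := by
      ext z
      simp [orderStat_lt_iff]
    rw [this]
    refine measurableSet_lt measurable_const (Finset.measurable_sum _ fun i _ => ?_)
    exact Measurable.ite (measurableSet_lt (by fun_prop) measurable_const)
      measurable_const measurable_const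
  exact (N.indep_users_eves.comp hv ((measurable_eveSup p).const_mul (p.ρe * p.am))).symm

/-- `H x` is the outage probability given eavesdropper SNR `x`. Beyond `τ` it is 1, which
contributes the tail `1 - cdfE τ`; below `τ` it is the ordered-gain CDF at the threshold. -/
theorem sop_eq [IsProbabilityMeasure μ] {R : ℝ} (hR : 0 < R) (hτ : 0 < p.τ R) :
    N.sop R = p.sopWith p.cdfU R := by
  have hmE := N.measurable_snrE
  have hmG := N.measurable_gainm
  have hprob : IsProbabilityMeasure (μ.map N.gainm) :=
    Measure.isProbabilityMeasure_map hmG.aemeasurable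
  set S : Set (ℝ × ℝ) := {z | max (Real.logb 2 (1 + p.am * z.2 / (p.an * z.2 + 1 / p.ρb)) -
    Real.logb 2 (1 + z.1)) 0 < R} with hSdef
  have hS : MeasurableSet S := by
    refine measurableSet_lt ?_ measurable_const
    simp only [Real.logb]
    fun_prop
  set H : ℝ → ℝ := fun x => (μ.map N.gainm).real (Prod.mk x ⁻¹' S) with hHdef
  have hHm : Measurable H := (measurable_measure_prodMk_left hS).ennreal_toReal
  have hH : ∀ x, H x = μ.real {ω | (x, N.gainm ω) ∈ S} := by
    intro x
    simp only [hHdef, measureReal_def]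
    rw [Measure.map_apply hmG (measurable_prodMk_left hS)]
    rfl
  have h1 : N.sop R = ∫ x, H x ∂(μ.map N.snrE) := by
    rw [integral_map hmE.aemeasurable hHm.aestronglyMeasurable]
    simp only [hH]
    exact measureReal_mem_of_indepFun hmE hmG N.indep_snrE_gainm hS
  have hHtop : ∀ x, p.τ R ≤ x → H x = 1 := by
    intro x hx
    have hx0 := hτ.le.trans hx
    rw [hH]
    have : {ω | (x, N.gainm ω) ∈ S} = Set.univ := by
      refine Set.eq_univ_of_forall fun ω => ?_
      refine (secrecy_outage_iff p.am_pos p.an_pos p.ρb_pos hR (N.gainm_nonneg ω) hx0).2 ?_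
      have h2 := NOMAParams.outage_threshold_pos hR hx0
      have h3 : p.am - p.an * (2 ^ R * (1 + x) - 1) ≤ 0 :=
        not_lt.1 fun h => hx.not_gt (p.lt_τ_iff.2 h)
      have h4 := N.gainm_nonneg ω
      have h5 := p.ρb_pos
      have h6 : (p.am - p.an * (2 ^ R * (1 + x) - 1)) * p.ρb * N.gainm ω ≤ 0 :=
        mul_nonpos_of_nonpos_of_nonneg (mul_nonpos_of_nonpos_of_nonneg h3 h5.le) h4
      linarith
    rw [this, probReal_univ]
  have hHbot : ∀ x, 0 ≤ x → x < p.τ R → H x = p.cdfOrd p.cdfU (p.thr R x) := by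
    intro x hx0 hx
    rw [hH, ← N.real_gainm_lt (p.thr_nonneg hR hx0 hx)]
    congr 1
    ext ω
    refine (secrecy_outage_iff p.am_pos p.an_pos p.ρb_pos hR (N.gainm_nonneg ω) hx0).trans ?_
    rw [Set.mem_ofPred_eq, NOMAParams.thr,
      lt_div_iff₀' (mul_pos (p.lt_τ_iff.1 hx) p.ρb_pos)]
  have hpm : AEMeasurable (fun x => (p.pdfE x).toNNReal) (volume.restrict (Set.Ioi 0)) :=
    p.integrableOn_pdfE.aemeasurable.real_toNNReal
  have h2 : N.sop R = ∫ x in Set.Ioi 0, p.pdfE x * H x := by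
    rw [h1, N.map_snrE]
    have := integral_withDensity_eq_integral_smul₀ hpm H
    simp only [ENNReal.ofReal] at this ⊢
    rw [this]
    refine setIntegral_congr_fun measurableSet_Ioi fun x hx => ?_
    simp only [NNReal.smul_def, smul_eq_mul]
    rw [Real.coe_toNNReal _ (p.pdfE_nonneg hx)]
  have hint : IntegrableOn (fun x => p.pdfE x * H x) (Set.Ioi 0) := by
    refine p.integrableOn_pdfE.mul_bdd (c := 1) hHm.aestronglyMeasurable ?_
    refine Filter.Eventually.of_forall fun x => ?_
    rw [Real.norm_of_nonneg measureReal_nonneg]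
    exact measureReal_le_one
  -- The threshold formula holds only strictly below `τ`, so the endpoint is removed before
  -- substituting and restored afterwards.
  rw [h2, ← Set.Ioc_union_Ioi_eq_Ioi hτ.le,
    setIntegral_union (Set.Ioc_disjoint_Ioi le_rfl) measurableSet_Ioi
      (hint.mono_set Set.Ioc_subset_Ioi_self) (hint.mono_set (Set.Ioi_subset_Ioi hτ.le)),
    setIntegral_congr_fun measurableSet_Ioi (g := p.pdfE)
      (fun x hx => by rw [hHtop x (le_of_lt hx), mul_one]),
    p.integral_Ioi_pdfE hτ, integral_Ioc_eq_integral_Ioo,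
    setIntegral_congr_fun measurableSet_Ioo
      (g := fun x => p.preE x * p.cdfE x * p.cdfOrd p.cdfU (p.thr R x))
      (fun x hx => by rw [hHbot x hx.1.le hx.2]; rfl),
    ← integral_Ioc_eq_integral_Ioo, ← intervalIntegral.integral_of_le hτ.le, add_comm]
  rfl

end NOMANetwork

/-! ### Gauss–Chebyshev quadrature as a midpoint rule -/

theorem tendsto_midpoint_sum {g : ℝ → ℝ} (hg : Continuous g) {b : ℝ} (hb : 0 < b) :
    Filter.Tendsto (fun K : ℕ => b / K * ∑ i ∈ Finset.range K, g ((2 * i + 1) / (2 * K) * b))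
      Filter.atTop (nhds (∫ x in (0 : ℝ)..b, g x)) := by
  have huc := (isCompact_Icc (a := (0 : ℝ)) (b := b)).uniformContinuousOn_of_continuous
    hg.continuousOn
  rw [Metric.uniformContinuousOn_iff] at huc
  rw [Metric.tendsto_atTop]
  intro ε hε
  -- With oscillation `ε / (2 * b)` on each cell, the total error over length `b` is at most `ε /
  -- 2`.
  obtain ⟨η, hη, hgη⟩ := huc (ε / (2 * b)) (by positivity)
  obtain ⟨K₀, hK₀⟩ := exists_nat_gt (b / η)
  refine ⟨K₀ + 1, fun K hK => ?_⟩
  have hK0 : (0 : ℝ) < K := by exact_mod_cast (show 0 < K by omega)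
  have hKη : b / K < η := by
    rw [div_lt_iff₀ hK0]
    rw [div_lt_iff₀ hη] at hK₀
    have : (K₀ : ℝ) ≤ K := by exact_mod_cast (show K₀ ≤ K by omega)
    nlinarith
  have hsplit : ∑ i ∈ Finset.range K, ∫ x in (b / K * i)..(b / K * (i + 1 : ℕ)), g x =
      ∫ x in (0 : ℝ)..b, g x := by
    rw [intervalIntegral.sum_integral_adjacent_intervals (a := fun i : ℕ => b / K * i)
      fun i _ => hg.intervalIntegrable _ _]
    simp [div_mul_cancel₀ _ hK0.ne']
  have hterm : ∀ i ∈ Finset.range K, |b / K * g ((2 * i + 1) / (2 * K) * b) -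
      ∫ x in (b / K * i)..(b / K * (i + 1 : ℕ)), g x| ≤ ε / (2 * b) * (b / K) := by
    intro i hi
    have hi' : (i : ℝ) + 1 ≤ K := by exact_mod_cast Finset.mem_range.1 hi
    have hc : b / K * g ((2 * i + 1) / (2 * K) * b) =
        ∫ x in (b / K * i)..(b / K * (i + 1 : ℕ)), g ((2 * i + 1) / (2 * K) * b) := by
      rw [intervalIntegral.integral_const, smul_eq_mul]
      push_cast
      ring
    have hle : b / K * i ≤ b / K * (i + 1 : ℕ) := by
      push_cast
      gcongr
      linarith
    have hmid : (2 * (i : ℝ) + 1) / (2 * K) * b = b / K * (i + 1 / 2) := by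
      field_simp
    have hlast : b / K * (i + 1) ≤ b := by
      calc b / K * (i + 1) ≤ b / K * K := by gcongr
        _ = b := div_mul_cancel₀ _ hK0.ne'
    have hbK : 0 < b / K := by positivity
    have hfst : 0 ≤ b / K * i := by positivity
    rw [hc, ← intervalIntegral.integral_sub (by simp) (hg.intervalIntegrable _ _), ← Real.norm_eq_abs]
    refine (intervalIntegral.norm_integral_le_of_norm_le_const (C := ε / (2 * b))
      fun x hx => ?_).trans_eq ?_
    · rw [Set.uIoc_of_le hle] at hx
      push_cast at hx
      rw [← dist_eq_norm]
      refine (hgη _ ?_ _ ?_ ?_).le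
      · rw [hmid]
        constructor <;> nlinarith
      · exact ⟨by linarith [hx.1], by linarith [hx.2]⟩
      · rw [hmid, Real.dist_eq, abs_lt]
        constructor <;> nlinarith [hx.1, hx.2]
    · congr 1
      push_cast
      rw [← mul_sub, add_sub_cancel_left, mul_one, abs_of_pos hbK]
  rw [Real.dist_eq, ← hsplit, Finset.mul_sum, ← Finset.sum_sub_distrib]
  calc _ ≤ ∑ i ∈ Finset.range K, ε / (2 * b) * (b / K) :=
        (Finset.abs_sum_le_sum_abs _ _).trans (Finset.sum_le_sum hterm)
    _ = ε / 2 := by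
      rw [Finset.sum_const, Finset.card_range, nsmul_eq_mul]
      field_simp
    _ < ε := by linarith

namespace NOMAParams

variable (p : NOMAParams)

theorem node_succ (K i : ℕ) : node K (i + 1) = Real.cos ((2 * i + 1) / (2 * K) * Real.pi) := by
  rw [node]
  push_cast
  ring_nf

theorem one_le_c_succ (K i : ℕ) : 1 ≤ p.c K (i + 1) := by
  have h1 : 0 ≤ node K (i + 1) + 1 := by
    rw [node]
    linarith [Real.neg_one_le_cos ((2 * ((i + 1 : ℕ) : ℝ) - 1) / (2 * K) * Real.pi)]
  have h2 := p.RD_pos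
  rw [c, if_neg (Nat.succ_ne_zero i)]
  have : 0 ≤ (p.RD / 2 * (node K (i + 1) + 1)) ^ p.α := by positivity
  linarith

theorem c_nonneg (K k : ℕ) : 0 ≤ p.c K k := by
  cases k with
  | zero => simp [c]
  | succ i => linarith [p.one_le_c_succ K i]

/-- The integrand of the unordered CDF in the angular variable. -/
noncomputable def angularIntegrand (y θ : ℝ) : ℝ :=
  Real.sin θ * (Real.cos θ + 1) *
    (1 - Real.exp (-((1 + (p.RD / 2 * (Real.cos θ + 1)) ^ p.α) * y)))

theorem continuous_angularIntegrand (y : ℝ) : Continuous (p.angularIntegrand y) := by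
  have : Continuous fun θ : ℝ => (p.RD / 2 * (Real.cos θ + 1)) ^ p.α :=
    (Real.continuous_rpow_const p.α_pos.le).comp (by fun_prop)
  unfold angularIntegrand
  fun_prop

/-- The coefficient `b_0` supplies the 1 in each `1 - exp`, and the minus sign in `bPos` makes the
resulting weights nonnegative. The nodes are cosines of the midpoints of `K` equal cells of `[0,
π]`, where the square root is a sine. -/
theorem cdfUGC_eq {K : ℕ} (y : ℝ) : p.cdfUGC K y = 1 / 2 * (Real.pi / K *
    ∑ i ∈ Finset.range K, p.angularIntegrand y ((2 * i + 1) / (2 * K) * Real.pi)) := by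
  have h0 : b K 0 = -∑ i ∈ Finset.range K, bPos K (i + 1) := by
    rw [b, if_pos rfl, Finset.range_eq_Ico, Finset.sum_Ico_add' (fun j => bPos K j)]
    rfl
  rw [cdfUGC, Finset.sum_range_succ', h0]
  simp only [c, if_pos, zero_mul, neg_zero, Real.exp_zero, mul_one, b, Nat.succ_ne_zero, if_false]
  rw [← sub_eq_add_neg, ← Finset.sum_sub_distrib, Finset.mul_sum, Finset.mul_sum]
  refine Finset.sum_congr rfl fun i hi => ?_
  have hi' : (i : ℝ) + 1 ≤ K := by exact_mod_cast Finset.mem_range.1 hi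
  have hK : (0 : ℝ) < K := by linarith [show (0 : ℝ) ≤ i from Nat.cast_nonneg i]
  have hs : √(1 - node K (i + 1) ^ 2) = Real.sin ((2 * i + 1) / (2 * K) * Real.pi) := by
    rw [node_succ, ← Real.abs_sin_eq_sqrt_one_sub_cos_sq, abs_of_nonneg]
    refine Real.sin_nonneg_of_nonneg_of_le_pi (by positivity) ?_
    refine mul_le_of_le_one_left Real.pi_pos.le ?_
    rw [div_le_one (by positivity)]
    linarith
  rw [bPos, hs, node_succ, angularIntegrand]
  field_simp
  ring

/-- Substitute `r = RD/2 (cos θ + 1)`; this reverses orientation, which absorbs the sign of the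
derivative of cosine. -/
theorem cdfU_eq (y : ℝ) :
    p.cdfU y = 1 / 2 * ∫ θ in (0 : ℝ)..Real.pi, p.angularIntegrand y θ := by
  have hRD := p.RD_pos
  have hg : Continuous fun r : ℝ => (1 - Real.exp (-((1 + r ^ p.α) * y))) * r := by
    have := Real.continuous_rpow_const p.α_pos.le
    fun_prop
  have h := intervalIntegral.integral_comp_mul_deriv (a := 0) (b := Real.pi)
    (f := fun θ => p.RD / 2 * (Real.cos θ + 1)) (f' := fun θ => p.RD / 2 * -Real.sin θ)
    (fun θ _ => ((Real.hasDerivAt_cos θ).add_const 1).const_mul _) (by fun_prop) hg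
  simp only [Real.cos_zero, Real.cos_pi, Function.comp_def] at h
  rw [show p.RD / 2 * (-1 + 1) = 0 by ring, show p.RD / 2 * (1 + 1) = p.RD by ring,
    intervalIntegral.integral_symm 0 p.RD] at h
  rw [cdfU, ← neg_eq_iff_eq_neg.2 h, ← intervalIntegral.integral_neg,
    ← intervalIntegral.integral_const_mul, ← intervalIntegral.integral_const_mul]
  refine intervalIntegral.integral_congr fun θ _ => ?_
  simp only [angularIntegrand]
  field_simp

theorem tendsto_cdfUGC (y : ℝ) :
    Filter.Tendsto (fun K => p.cdfUGC K y) Filter.atTop (nhds (p.cdfU y)) := by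
  simp only [p.cdfUGC_eq, p.cdfU_eq]
  exact (tendsto_midpoint_sum (p.continuous_angularIntegrand y) Real.pi_pos).const_mul _

/-- The angular integrand is at most 2 in absolute value, and the weights total `π / 2`. Uniformity
in `K` and `y` is what dominated convergence needs. -/
theorem abs_cdfUGC_le (K : ℕ) {y : ℝ} (hy : 0 ≤ y) : |p.cdfUGC K y| ≤ Real.pi := by
  rcases Nat.eq_zero_or_pos K with rfl | hK
  · simp [p.cdfUGC_eq, Real.pi_pos.le]
  have hK0 : (0 : ℝ) < K := by exact_mod_cast hK
  have hRD := p.RD_pos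
  have hb : ∀ θ, |p.angularIntegrand y θ| ≤ 2 := by
    intro θ
    have h1 := Real.abs_sin_le_one θ
    have h2 : 0 ≤ Real.cos θ + 1 := by linarith [Real.neg_one_le_cos θ]
    have h3 : Real.cos θ + 1 ≤ 2 := by linarith [Real.cos_le_one θ]
    have h4 : Real.exp (-((1 + (p.RD / 2 * (Real.cos θ + 1)) ^ p.α) * y)) ≤ 1 := by
      rw [Real.exp_le_one_iff, neg_nonpos]
      positivity
    have h5 := Real.exp_pos (-((1 + (p.RD / 2 * (Real.cos θ + 1)) ^ p.α) * y))
    rw [angularIntegrand, abs_mul, abs_mul, abs_of_nonneg h2, abs_of_nonneg (sub_nonneg.2 h4)]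
    have h6 := mul_le_mul h1 h3 h2 zero_le_one
    exact (mul_le_mul h6 (sub_le_self 1 h5.le) (sub_nonneg.2 h4) (by norm_num)).trans_eq
      (by norm_num)
  rw [p.cdfUGC_eq, abs_mul, abs_mul, abs_of_pos (show 0 < Real.pi / K by positivity)]
  calc _ ≤ |1 / 2| * (Real.pi / K * ∑ i ∈ Finset.range K, (2 : ℝ)) := by
        gcongr
        exact (Finset.abs_sum_le_sum_abs _ _).trans (Finset.sum_le_sum fun i _ => hb _)
    _ = Real.pi := by
      rw [Finset.sum_const, Finset.card_range, nsmul_eq_mul, abs_of_pos (by norm_num)]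
      field_simp

/-! ### Multinomial expansion and the limit in the number of nodes -/

theorem abs_cdfOrd_le {F : ℝ → ℝ} {y B : ℝ} (h : |F y| ≤ B) :
    |p.cdfOrd F y| ≤ |p.φ| * ∑ l ∈ Finset.range (p.M - p.m + 1),
      |((p.M - p.m).choose l : ℝ) * ((-1) ^ l / (p.m + l : ℝ))| * B ^ (p.m + l) := by
  rw [cdfOrd, abs_mul]
  gcongr
  refine (Finset.abs_sum_le_sum_abs _ _).trans (Finset.sum_le_sum fun l _ => ?_)
  rw [abs_mul _ (F y ^ _), abs_pow]
  gcongr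

@[fun_prop]
theorem measurable_thr (R : ℝ) : Measurable (p.thr R) := by
  unfold thr
  fun_prop

theorem integrand_eq (K : ℕ) (R : ℝ) (q : Fin (K + 1) → ℕ) (x : ℝ) : p.integrand K R q x =
    p.pdfE x * Real.exp (-∑ k : Fin (K + 1), (q k : ℝ) * p.c K k * p.thr R x) := by
  rw [integrand, sub_eq_add_neg, Real.exp_add, ← mul_assoc]
  rfl

theorem intervalIntegrable_integrand {R : ℝ} (hR : 0 < R) (hτ : 0 < p.τ R) (K : ℕ)
    (q : Fin (K + 1) → ℕ) : IntervalIntegrable (p.integrand K R q) volume 0 (p.τ R) := by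
  rw [intervalIntegrable_iff_integrableOn_Ioo_of_le hτ.le,
    show p.integrand K R q = _ from funext (p.integrand_eq K R q)]
  refine (p.integrableOn_pdfE.mono_set Set.Ioo_subset_Ioi_self).mul_bdd (c := 1)
    (Measurable.aestronglyMeasurable (by fun_prop)) ?_
  filter_upwards [ae_restrict_mem measurableSet_Ioo] with x hx
  rw [Real.norm_of_nonneg (Real.exp_pos _).le, Real.exp_le_one_iff, neg_nonpos]
  exact Finset.sum_nonneg fun k _ => mul_nonneg
    (mul_nonneg (Nat.cast_nonneg _) (p.c_nonneg K k)) (p.thr_nonneg hR hx.1.le hx.2)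

theorem cdfUGC_pow (K j : ℕ) (y : ℝ) : p.cdfUGC K y ^ j =
    ∑ q ∈ Finset.piAntidiag (Finset.univ : Finset (Fin (K + 1))) j,
      (Nat.multinomial Finset.univ q : ℝ) * (∏ k : Fin (K + 1), b K k ^ q k) *
        Real.exp (-∑ k : Fin (K + 1), (q k : ℝ) * p.c K k * y) := by
  rw [cdfUGC, Finset.sum_range, Finset.sum_pow_eq_sum_piAntidiag]
  refine Finset.sum_congr rfl fun q _ => ?_
  rw [mul_assoc, ← Finset.sum_neg_distrib, Real.exp_sum, ← Finset.prod_mul_distrib]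
  congr 1
  refine Finset.prod_congr rfl fun k _ => ?_
  rw [mul_pow, ← Real.exp_nat_mul]
  congr 2
  ring

/-- The multinomial theorem expands each power of the quadrature sum; integrability of every term
lets the finite sums leave the integral. -/
theorem sopFormula_eq {R : ℝ} (hR : 0 < R) (hτ : 0 < p.τ R) (K : ℕ) :
    p.sopFormula K R = p.sopWith (p.cdfUGC K) R := by
  have hI := p.intervalIntegrable_integrand hR hτ K
  rw [sopFormula, sopWith, cdfE, mul_comm (p.τ R) p.μ2]
  congr 1
  have h : ∀ x, p.preE x * p.cdfE x * p.cdfOrd (p.cdfUGC K) (p.thr R x) =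
      p.φ * ∑ l ∈ Finset.range (p.M - p.m + 1),
      ((p.M - p.m).choose l : ℝ) * ((-1) ^ l / (p.m + l : ℝ)) *
        ∑ q ∈ Finset.piAntidiag (Finset.univ : Finset (Fin (K + 1))) (p.m + l),
          (Nat.multinomial Finset.univ q : ℝ) * (∏ k : Fin (K + 1), b K k ^ q k) *
            p.integrand K R q x := by
    intro x
    rw [cdfOrd, mul_left_comm, Finset.mul_sum]
    congr 1
    refine Finset.sum_congr rfl fun l _ => ?_
    rw [mul_left_comm, cdfUGC_pow, Finset.mul_sum]
    congr 1
    refine Finset.sum_congr rfl fun q _ => ?_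
    rw [mul_left_comm, p.integrand_eq]
    rfl
  simp only [h]
  rw [intervalIntegral.integral_const_mul, intervalIntegral.integral_finsetSum]
  · congr 1
    refine Finset.sum_congr rfl fun l _ => ?_
    rw [intervalIntegral.integral_const_mul, intervalIntegral.integral_finsetSum]
    · simp only [intervalIntegral.integral_const_mul]
    · exact fun q _ => (hI q).const_mul _
  · intro l _
    refine IntervalIntegrable.const_mul ?_ _
    have := IntervalIntegrable.sum (Finset.piAntidiag (Finset.univ : Finset (Fin (K + 1))) (p.m + l))
      fun q _ => (hI q).const_mul
        ((Nat.multinomial Finset.univ q : ℝ) * (∏ k : Fin (K + 1), b K k ^ q k))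
    convert! this using 1
    funext x
    simp

theorem tendsto_sopWith_cdfUGC {R : ℝ} (hR : 0 < R) (hτ : 0 < p.τ R) :
    Filter.Tendsto (fun K => p.sopWith (p.cdfUGC K) R) Filter.atTop
      (nhds (p.sopWith p.cdfU R)) := by
  set C := |p.φ| * ∑ l ∈ Finset.range (p.M - p.m + 1),
      |((p.M - p.m).choose l : ℝ) * ((-1) ^ l / (p.m + l : ℝ))| * Real.pi ^ (p.m + l) with hC
  refine tendsto_const_nhds.add ?_
  have hI := p.intervalIntegrable_pdfE hτ.le
  -- `thr_nonneg` requires `x < τ`, so the domination is proved off this null endpoint.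
  have hne : ∀ᵐ x : ℝ, x ≠ p.τ R := by simp [ae_iff]
  refine intervalIntegral.tendsto_integral_filter_of_dominated_convergence
    (fun x => p.pdfE x * C) ?_ ?_ (hI.mul_const C) ?_
  · refine Filter.Eventually.of_forall fun K => ?_
    have hm : Measurable fun x => p.cdfOrd (p.cdfUGC K) (p.thr R x) := by
      unfold cdfOrd cdfUGC
      fun_prop
    rw [Set.uIoc_of_le hτ.le]
    exact hI.1.aestronglyMeasurable.mul hm.aestronglyMeasurable
  · refine Filter.Eventually.of_forall fun K => ?_
    filter_upwards [hne] with x hx hx'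
    rw [Set.uIoc_of_le hτ.le] at hx'
    have h1 := p.pdfE_nonneg hx'.1
    have h2 := p.thr_nonneg hR hx'.1.le (lt_of_le_of_ne hx'.2 hx)
    change ‖p.pdfE x * _‖ ≤ _
    rw [norm_mul, Real.norm_of_nonneg h1]
    exact mul_le_mul_of_nonneg_left (p.abs_cdfOrd_le (p.abs_cdfUGC_le K h2)) h1
  · refine Filter.Eventually.of_forall fun x _ => Filter.Tendsto.const_mul _ ?_
    refine Filter.Tendsto.const_mul _ (tendsto_finsetSum _ fun l _ => ?_)
    exact Filter.Tendsto.const_mul _ ((p.tendsto_cdfUGC _).pow _)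

end NOMAParams

theorem theorem2 (p : NOMAParams) {Ω : Type*} [MeasurableSpace Ω] (μ : Measure Ω)
    [IsProbabilityMeasure μ] (N : NOMANetwork p μ) (R : ℝ) (hR : 0 < R) (hτ : 0 < p.τ R) :
    (∀ᵐ ω ∂μ, BddAbove (N.eveGains ω)) ∧
    N.sop R = p.sopWith p.cdfU R ∧
    (∀ K : ℕ, 1 ≤ K →
      (∀ q : Fin (K + 1) → ℕ, IntervalIntegrable (p.integrand K R q) volume 0 (p.τ R)) ∧
      p.sopFormula K R = p.sopWith (p.cdfUGC K) R) ∧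
    Filter.Tendsto (fun K : ℕ => p.sopFormula K R) Filter.atTop (nhds (N.sop R)) := by
  refine ⟨N.bddAbove_eveGains, N.sop_eq hR hτ, fun K _ =>
    ⟨p.intervalIntegrable_integrand hR hτ K, p.sopFormula_eq hR hτ K⟩, ?_⟩
  rw [N.sop_eq hR hτ]
  simp only [p.sopFormula_eq hR hτ]
  exact p.tendsto_sopWith_cdfUGC hR hτ
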